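/- **Setting.** Let $n\ge 1$ and let $(\Omega,\mathcal A,\mu)$ be a probability space with an ergodic $n$-dimensional dynamical system $T_x:\Omega\to\Omega$, $x\in\mathbb R^n$. That is: $T_0=\mathrm{id}$ and $T_{x+y}=T_xT_y$; for $x\in\mathbb R^n$ and $A\in\mathcal A$ one has $T_xA\in\mathcal A$ and $\mu(T_xA)=\mu(A)$; for every measurable $g:\Omega\to\mathbb R^m$ the map $(x,\omega)\mapsto g(T_x\omega)$ is measurable on $\mathbb R^n\times\Omega$; and every measurable $g:\Omega\to\mathbb R$ such that, for each $x$, $g(T_x\omega)=g(\omega)$ for a.e. $\omega$, is a.e. constant. Let $1<p<\infty$, $q=p/(p-1)$, and write $\mathbb E(g)=\int_\Omega g\,d\mu$. A field $w\in L^r_{\rm loc}(\mathbb R^n;\mathbb R^n)$ is *solenoidal* if $\sum_i\int w^i\,\partial_i\varphi\,dx=0$, and *potential* if $\int (w^i\partial_j\varphi-w^j\partial_i\varphi)\,dx=0$ for all $i,j$, for all $\varphi\in C_c^\infty(\mathbb R^n)$. Let $L^r_{\rm sol}(\Omega)$ (resp. $L^r_{\rm pot}(\Omega)$) be the set of $g\in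 L^r(\Omega;\mathbb R^n)$ such that for a.e. $\omega$ the realization $x\mapsto g(T_x\omega)$ is solenoidal (resp. potential), and let $\mathcal V^r_{\rm sol}$, $\mathcal V^r_{\rm pot}$ be their subsets with $\mathbb E(g)=0$. Let $\alpha:\mathbb R^n\times\Omega\to\mathcal P(\mathbb R^n)$ be a random maximal monotone operator: $\{(x,\omega):\alpha(x,\omega)\cap R\ne\emptyset\}$ is $\mathcal B(\mathbb R^n)\otimes\mathcal A$-measurable for every open $R\subseteq\mathbb R^n$; for every $x$, $\alpha(x,\omega)$ is closed for a.e. $\omega$; and $\alpha(\cdot,\omega)$ is maximal monotone for a.e. $\omega$. Let $f:\mathbb R^n\times\mathbb R^n\times\Omega\to\mathbb R\cup\{+\infty\}$ be a measurable representative function of $\alpha$: $f$ is $\mathcal B(\mathbb R^n\times\mathbb R^n)\otimes\mathcal A$-measurable and, for a.e. $\omega$, $f(\cdot,\cdot,\omega)$ is convex and lower semicontinuous, $f(x,y,\omega)\ge y\cdot x$ for all $x,y$, and $$y\in\alpha(x,\omega)\iff f(x,y,\omega)=y\cdot x\qquad\text{for all }x,y\in\mathbb R^n.$$ Assume that there are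 $c>0$ and $k\in L^1(\Omega)$ with $f(\xi,\eta,\omega)\ge c(|\xi|^p+|\eta|^q)+k(\omega)$ for all $\xi,\eta\in\mathbb R^n$, $\omega\in\Omega$. Define $$f_0(\xi,\eta):=\inf\Big\{\int_\Omega f(\xi+u(\omega),\eta+v(\omega),\omega)\,d\mu:\ u\in\mathcal V^p_{\rm sol},\ v\in\mathcal V^q_{\rm pot}\Big\},\qquad \eta\in\alpha_0(\xi)\iff f_0(\xi,\eta)=\xi\cdot\eta .$$ **Lemma (scale disintegration).** Let $\xi,\eta\in\mathbb R^n$ be such that $\eta\in\alpha_0(\xi)$. Then there exist $u\in L^p_{\rm sol}(\Omega)$ and $v\in L^q_{\rm pot}(\Omega)$ such that $$v(\omega)\in\alpha(u(\omega),\omega)\quad\text{for a.e. }\omega\in\Omega,\qquad \mathbb E(u)=\xi,\qquad \mathbb E(v)=\eta,$$ and hence $\mathbb E(v)\in\alpha_0(\mathbb E(u))$. -/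

import Mathlib

open MeasureTheory
open scoped ENNReal

noncomputable section

namespace ScaleInt

/-- The Euclidean space `ℝⁿ` (also used as its own dual, through the scalar product). -/
abbrev E (n : ℕ) : Type := EuclideanSpace ℝ (Fin n)

/-! ### Maximal monotone operators and their representation -/

/-- A set-valued operator on `ℝⁿ` is monotone. -/
def IsMonotone {n : ℕ} (a : E n → Set (E n)) : Prop :=
  ∀ x y, y ∈ a x → ∀ x₀ y₀, y₀ ∈ a x₀ → 0 ≤ inner ℝ (y - y₀) (x - x₀)

/-- A monotone operator is maximal monotone if each `(x, y)` that is monotonically related to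
its whole graph belongs to the graph. -/
def IsMaximalMonotone {n : ℕ} (a : E n → Set (E n)) : Prop :=
  IsMonotone a ∧
    ∀ x y, (∀ x₀ y₀, y₀ ∈ a x₀ → 0 ≤ inner ℝ (y - y₀) (x - x₀)) → y ∈ a x

/-- A random maximal monotone operator: measurable, closed-valued, and maximal monotone
for almost every `ω`. -/
structure IsRandomMaximalMonotone {n : ℕ} {Ω : Type*} [MeasurableSpace Ω] (μ : Measure Ω)
    (α : E n → Ω → Set (E n)) : Prop where
  measurable : ∀ R : Set (E n), IsOpen R →
    MeasurableSet {z : E n × Ω | (α z.1 z.2 ∩ R).Nonempty}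
  closed : ∀ x, ∀ᵐ ω ∂μ, IsClosed (α x ω)
  maximal : ∀ᵐ ω ∂μ, IsMaximalMonotone (fun x => α x ω)

/-- Measurable representative functions `f : ℝⁿ × ℝⁿ × Ω → ℝ ∪ {+∞}`. -/
structure IsMeasurableRepresentative {n : ℕ} {Ω : Type*} [MeasurableSpace Ω] (μ : Measure Ω)
    (f : E n → E n → Ω → EReal) : Prop where
  ne_bot : ∀ x y ω, f x y ω ≠ ⊥
  measurable : Measurable (fun z : (E n × E n) × Ω => f z.1.1 z.1.2 z.2)
  convex : ∀ᵐ ω ∂μ, ∀ (x y x' y' : E n) (s t : ℝ), 0 < s → 0 < t → s + t = 1 →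
    f (s • x + t • x') (s • y + t • y') ω ≤ (s : EReal) * f x y ω + (t : EReal) * f x' y' ω
  lsc : ∀ᵐ ω ∂μ, LowerSemicontinuous (fun z : E n × E n => f z.1 z.2 ω)
  ge_inner : ∀ᵐ ω ∂μ, ∀ x y, ((inner ℝ y x : ℝ) : EReal) ≤ f x y ω

/-- `f` represents `α`: for almost every `ω`, the graph of `α(·, ω)` is the set on which
`f(x, y, ω) = y · x`. -/
def Represents {n : ℕ} {Ω : Type*} [MeasurableSpace Ω] (μ : Measure Ω)
    (f : E n → E n → Ω → EReal) (α : E n → Ω → Set (E n)) : Prop :=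
  ∀ᵐ ω ∂μ, ∀ x y, y ∈ α x ω ↔ f x y ω = ((inner ℝ y x : ℝ) : EReal)

/-- Coercivity: `f(ξ, η, ω) ≥ c (|ξ|^p + |η|^q) + k(ω)` with `c > 0` and `k ∈ L¹(Ω)`. -/
def IsCoercive {n : ℕ} {Ω : Type*} [MeasurableSpace Ω] (μ : Measure Ω) (p q : ℝ)
    (f : E n → E n → Ω → EReal) : Prop :=
  ∃ (c : ℝ) (k : Ω → ℝ), 0 < c ∧ Integrable k μ ∧
    ∀ ξ η ω, ((c * (‖ξ‖ ^ p + ‖η‖ ^ q) + k ω : ℝ) : EReal) ≤ f ξ η ω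

/-! ### Dynamical systems -/

/-- An `n`-dimensional (measure preserving, measurable) dynamical system on `Ω`. -/
structure IsDynamicalSystem {n : ℕ} {Ω : Type*} [MeasurableSpace Ω] (μ : Measure Ω)
    (T : E n → Ω → Ω) : Prop where
  zero : ∀ ω, T 0 ω = ω
  add : ∀ x y ω, T (x + y) ω = T x (T y ω)
  measurableSet_image : ∀ x A, MeasurableSet A → MeasurableSet (T x '' A)
  measure_image : ∀ x A, MeasurableSet A → μ (T x '' A) = μ A
  measurable_comp : ∀ (m : ℕ) (f : Ω → E m), Measurable f →
    Measurable (fun z : E n × Ω => f (T z.1 z.2))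

/-- Ergodicity: the only invariant measurable functions are the (a.e.) constants. -/
def IsErgodic {n : ℕ} {Ω : Type*} [MeasurableSpace Ω] (μ : Measure Ω)
    (T : E n → Ω → Ω) : Prop :=
  ∀ f : Ω → ℝ, Measurable f → (∀ x, ∀ᵐ ω ∂μ, f (T x ω) = f ω) →
    ∃ c : ℝ, ∀ᵐ ω ∂μ, f ω = c

/-! ### Potential and solenoidal fields -/

/-- Membership in `L^p_loc(ℝⁿ; ℝⁿ)`. -/
def MemLpLoc {n : ℕ} (p : ℝ) (v : E n → E n) : Prop :=
  ∀ K : Set (E n), IsCompact K → MemLp v (ENNReal.ofReal p) (volume.restrict K)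

/-- Test functions: smooth and compactly supported. -/
def IsTest {n : ℕ} (φ : E n → ℝ) : Prop := ContDiff ℝ ((⊤ : ℕ∞) : WithTop ℕ∞) φ ∧ HasCompactSupport φ

/-- The partial derivative `∂φ/∂x_i`. -/
def partialDeriv {n : ℕ} (i : Fin n) (φ : E n → ℝ) (x : E n) : ℝ :=
  fderiv ℝ φ x (EuclideanSpace.single i 1)

/-- `v ∈ L^p_loc` is potential: its curl vanishes in the sense of distributions. -/
def IsPotential {n : ℕ} (p : ℝ) (v : E n → E n) : Prop :=
  MemLpLoc p v ∧ ∀ (i j : Fin n) (φ : E n → ℝ), IsTest φ →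
    ∫ x, (v x i * partialDeriv j φ x - v x j * partialDeriv i φ x) = 0

/-- `v ∈ L^p_loc` is solenoidal: its divergence vanishes in the sense of distributions. -/
def IsSolenoidal {n : ℕ} (p : ℝ) (v : E n → E n) : Prop :=
  MemLpLoc p v ∧ ∀ φ : E n → ℝ, IsTest φ →
    ∑ i, ∫ x, v x i * partialDeriv i φ x = 0

/-- `L^p_pot(Ω; ℝⁿ)`: the `f ∈ L^p` almost all of whose realizations `x ↦ f (T_x ω)` are
potential. -/
def LpPot {n : ℕ} {Ω : Type*} [MeasurableSpace Ω] (μ : Measure Ω) (T : E n → Ω → Ω) (p : ℝ) :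
    Set (Ω → E n) :=
  {f | MemLp f (ENNReal.ofReal p) μ ∧ ∀ᵐ ω ∂μ, IsPotential p (fun x => f (T x ω))}

/-- `L^p_sol(Ω; ℝⁿ)`: the `f ∈ L^p` almost all of whose realizations `x ↦ f (T_x ω)` are
solenoidal. -/
def LpSol {n : ℕ} {Ω : Type*} [MeasurableSpace Ω] (μ : Measure Ω) (T : E n → Ω → Ω) (p : ℝ) :
    Set (Ω → E n) :=
  {f | MemLp f (ENNReal.ofReal p) μ ∧ ∀ᵐ ω ∂μ, IsSolenoidal p (fun x => f (T x ω))}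

/-- The mean-zero potential fields `V^p_pot`. -/
def VPot {n : ℕ} {Ω : Type*} [MeasurableSpace Ω] (μ : Measure Ω) (T : E n → Ω → Ω) (p : ℝ) :
    Set (Ω → E n) :=
  {f | f ∈ LpPot μ T p ∧ ∫ ω, f ω ∂μ = 0}

/-- The mean-zero solenoidal fields `V^p_sol`. -/
def VSol {n : ℕ} {Ω : Type*} [MeasurableSpace Ω] (μ : Measure Ω) (T : E n → Ω → Ω) (p : ℝ) :
    Set (Ω → E n) :=
  {f | f ∈ LpSol μ T p ∧ ∫ ω, f ω ∂μ = 0}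

/-! ### Scale integration -/

/-- The integral of an extended-real function, as the integral of the positive part minus that
of the negative part. It is the usual one if one of the two is finite, as is the case for
functions bounded below by an integrable function. -/
def extIntegral {Ω : Type*} [MeasurableSpace Ω] (μ : Measure Ω) (g : Ω → EReal) : EReal :=
  ((∫⁻ ω, (g ω).toENNReal ∂μ : ℝ≥0∞) : EReal) - ((∫⁻ ω, (-g ω).toENNReal ∂μ : ℝ≥0∞) : EReal)

/-- The homogenized representation `f₀`. -/
def homogenized {n : ℕ} {Ω : Type*} [MeasurableSpace Ω] (μ : Measure Ω) (T : E n → Ω → Ω)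
    (p q : ℝ) (f : E n → E n → Ω → EReal) (ξ η : E n) : EReal :=
  ⨅ u ∈ VSol μ T p, ⨅ v ∈ VPot μ T q, extIntegral μ (fun ω => f (ξ + u ω) (η + v ω) ω)

/-- The scale integration `α₀`, the operator on `ℝⁿ` represented by `f₀`. -/
def scaleIntegration {n : ℕ} {Ω : Type*} [MeasurableSpace Ω] (μ : Measure Ω) (T : E n → Ω → Ω)
    (p q : ℝ) (f : E n → E n → Ω → EReal) (ξ : E n) : Set (E n) :=
  {η | homogenized μ T p q f ξ η = ((inner ℝ ξ η : ℝ) : EReal)}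

end ScaleInt

end

namespace ScaleInt

open Filter Topology

/-! ### Measure preserving actions -/

section Dynamics

variable {n : ℕ} {Ω : Type*} [MeasurableSpace Ω] {μ : Measure Ω} {T : E n → Ω → Ω}

/-! The infimum defining `homogenized` is attained, and a minimizer must lie on the graph of `α`.
After adding the means `ξ`, `η` to the competitors, a minimizing pair satisfies `E(f(u, v, ·)) ≤ ξ ·
η`. The stochastic div-curl identity gives `E(u · v) = E(u) · E(v) = ξ · η`. Since `f(u, v, ·) ≥ u ·
v` almost everywhere, the difference is nonnegative with zero integral, hence vanishes almost
everywhere; because `f` represents `α`, this says `v ∈ α(u)`.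

Existence (`exists_lintegral_excess_le`) is the direct method with almost everywhere convergence in
place of weak compactness. The almost minimizers of `f` to within `1/(j+1)` form a decreasing
sequence of convex sets; choosing in each a near-minimizer of the strictly convex functional `∫
bracket` forces the choices to be Cauchy in measure (`exists_nearMinimizer_tendsto`). Coercivity
bounds them in `L^p × L^q` with `p, q > 1`, so the limit keeps the means and, by
`LpAnn.of_tendsto_ae`, the differential constraints. Fatou and lower semicontinuity then bound the
functional at the limit.

For the div-curl identity (`integral_inner_sol_pot`), `v` is mollified along orbits into a field
`w`. A derivative of the mollified potential field is the gradient of a stationary function, to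
which a solenoidal `u` is orthogonal (`IsDynamicalSystem.sum_integral_mul_orbitAvg_eq_zero`). Hence
`h ↦ E(u · w(T_h))` has zero gradient and is constant. By ergodicity the constant is `E(u) · E(w)`
(`IsErgodic.eq_inner_integral`): near-minimizers of `∫ bracket` on a convex translation-invariant
set containing `w` converge to an invariant, hence constant, field. Removing the mollification
finishes. -/

theorem IsDynamicalSystem.apply_neg (hT : IsDynamicalSystem μ T) (x : E n) (ω : Ω) :
    T x (T (-x) ω) = ω := by
  rw [← hT.add, add_neg_cancel, hT.zero]

theorem IsDynamicalSystem.neg_apply (hT : IsDynamicalSystem μ T) (x : E n) (ω : Ω) :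
    T (-x) (T x ω) = ω := by
  rw [← hT.add, neg_add_cancel, hT.zero]

/-- The dynamical system only provides measurability of compositions with vector-valued functions;
the indicator of a set, valued in `E 1`, recovers the preimage of that set. -/
theorem IsDynamicalSystem.measurable_uncurry (hT : IsDynamicalSystem μ T) :
    Measurable (fun z : E n × Ω => T z.1 z.2) := by
  classical
  intro A hA
  have h := hT.measurable_comp 1 (A.indicator fun _ => EuclideanSpace.single 0 1)
    (measurable_const.indicator hA)
  have h2 := h (measurableSet_singleton (0 : E 1)).compl
  convert h2 using 1
  ext z
  by_cases hz : T z.1 z.2 ∈ A <;> simp [hz]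

theorem IsDynamicalSystem.measurable (hT : IsDynamicalSystem μ T) (x : E n) :
    Measurable (T x) :=
  hT.measurable_uncurry.comp (measurable_const.prodMk measurable_id)

/-- The hypotheses concern images of sets; the group law makes the preimage under `T x` the image
under `T (-x)`. -/
theorem IsDynamicalSystem.measurePreserving (hT : IsDynamicalSystem μ T) (x : E n) :
    MeasurePreserving (T x) μ μ := by
  refine ⟨hT.measurable x, ?_⟩
  ext A hA
  rw [Measure.map_apply (hT.measurable x) hA, ← hT.measure_image (-x) A hA]
  congr 1
  ext ω
  constructor
  · intro h
    exact ⟨_, h, hT.neg_apply x ω⟩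
  · rintro ⟨ω', h, rfl⟩
    simpa [hT.apply_neg] using h

theorem IsDynamicalSystem.memLp_comp (hT : IsDynamicalSystem μ T) (x : E n)
    {F : Type*} [NormedAddCommGroup F] {g : Ω → F} {r : ℝ≥0∞} (hg : MemLp g r μ) :
    MemLp (fun ω => g (T x ω)) r μ :=
  hg.comp_measurePreserving (hT.measurePreserving x)

theorem IsDynamicalSystem.eLpNorm_comp (hT : IsDynamicalSystem μ T) (x : E n)
    {F : Type*} [NormedAddCommGroup F] {g : Ω → F} {r : ℝ≥0∞} (hg : AEStronglyMeasurable g μ) :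
    eLpNorm (fun ω => g (T x ω)) r μ = eLpNorm g r μ :=
  eLpNorm_comp_measurePreserving hg (hT.measurePreserving x)

theorem IsDynamicalSystem.integral_comp (hT : IsDynamicalSystem μ T) (x : E n)
    {F : Type*} [NormedAddCommGroup F] [NormedSpace ℝ F] {g : Ω → F}
    (hg : AEStronglyMeasurable g μ) : ∫ ω, g (T x ω) ∂μ = ∫ ω, g ω ∂μ := by
  have hx := hT.measurePreserving x
  conv_rhs => rw [← hx.map_eq]
  rw [integral_map hx.measurable.aemeasurable (by rwa [hx.map_eq])]

variable [SFinite μ]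

/-- The shear `(x, ω) ↦ (x, T_x ω)` preserves product measures. -/
theorem IsDynamicalSystem.measurePreserving_shear (hT : IsDynamicalSystem μ T)
    (ν : Measure (E n)) [SFinite ν] :
    MeasurePreserving (fun z : E n × Ω => (z.1, T z.1 z.2)) (ν.prod μ) (ν.prod μ) :=
  (MeasurePreserving.id ν).skew_product hT.measurable_uncurry
    (Eventually.of_forall fun x => (hT.measurePreserving x).map_eq)

theorem IsDynamicalSystem.quasiMeasurePreserving (hT : IsDynamicalSystem μ T)
    (ν : Measure (E n)) [SFinite ν] :
    Measure.QuasiMeasurePreserving (fun z : E n × Ω => T z.1 z.2) (ν.prod μ) μ :=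
  Measure.quasiMeasurePreserving_snd.comp
    (hT.measurePreserving_shear ν).quasiMeasurePreserving

theorem IsDynamicalSystem.aestronglyMeasurable_uncurry (hT : IsDynamicalSystem μ T)
    (ν : Measure (E n)) [SFinite ν] {F : Type*} [TopologicalSpace F] {g : Ω → F}
    (hg : AEStronglyMeasurable g μ) :
    AEStronglyMeasurable (fun z : E n × Ω => g (T z.1 z.2)) (ν.prod μ) :=
  hg.comp_quasiMeasurePreserving (hT.quasiMeasurePreserving ν)

theorem IsDynamicalSystem.aestronglyMeasurable_uncurry_swap (hT : IsDynamicalSystem μ T)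
    (ν : Measure (E n)) [SFinite ν] {F : Type*} [TopologicalSpace F] {g : Ω → F}
    (hg : AEStronglyMeasurable g μ) :
    AEStronglyMeasurable (fun z : Ω × E n => g (T z.2 z.1)) (μ.prod ν) :=
  (hT.aestronglyMeasurable_uncurry ν hg).comp_quasiMeasurePreserving
    (Measure.measurePreserving_swap (μ := μ) (ν := ν)).quasiMeasurePreserving

theorem IsDynamicalSystem.ae_aestronglyMeasurable (hT : IsDynamicalSystem μ T)
    (ν : Measure (E n)) [SFinite ν] {F : Type*} [TopologicalSpace F] {g : Ω → F}
    (hg : AEStronglyMeasurable g μ) :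
    ∀ᵐ ω ∂μ, AEStronglyMeasurable (fun x => g (T x ω)) ν :=
  (hT.aestronglyMeasurable_uncurry_swap ν hg).prodMk_left

/-- Averaging over space and `ω` reduces to averaging over `ω`. -/
theorem IsDynamicalSystem.lintegral_lintegral (hT : IsDynamicalSystem μ T)
    (ν : Measure (E n)) [SFinite ν] {g : Ω → ℝ≥0∞} (hg : AEMeasurable g μ) :
    ∫⁻ ω, ∫⁻ x, g (T x ω) ∂ν ∂μ = ν Set.univ * ∫⁻ ω, g ω ∂μ := by
  have h1 : AEMeasurable (fun z : E n × Ω => g (T z.1 z.2)) (ν.prod μ) :=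
    hg.comp_quasiMeasurePreserving (hT.quasiMeasurePreserving ν)
  rw [lintegral_lintegral_symm (f := fun ω x => g (T x ω)), lintegral_prod _ h1]
  · have : ∀ x, ∫⁻ ω, g (T x ω) ∂μ = ∫⁻ ω, g ω ∂μ := fun x => by
      have hx := hT.measurePreserving x
      conv_rhs => rw [← hx.map_eq]
      rw [lintegral_map' (by rwa [hx.map_eq]) hx.measurable.aemeasurable]
    simp [this, mul_comm]
  · exact h1.comp_quasiMeasurePreserving
      (Measure.measurePreserving_swap (μ := μ) (ν := ν)).quasiMeasurePreserving

/-- Almost every realization of an `L^r` function is in `L^r_loc`. -/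
theorem IsDynamicalSystem.ae_memLpLoc (hT : IsDynamicalSystem μ T) {r : ℝ} (hr : 0 < r)
    {g : Ω → E n} (hg : MemLp g (ENNReal.ofReal r) μ) :
    ∀ᵐ ω ∂μ, MemLpLoc r (fun x => g (T x ω)) := by
  have hr0 : ENNReal.ofReal r ≠ 0 := by simpa using hr
  -- Countably many balls exhaust all compact sets, so a single null set suffices.
  have key : ∀ᵐ ω ∂μ, ∀ R : ℕ, MemLp (fun x => g (T x ω)) (ENNReal.ofReal r)
      (volume.restrict (Metric.closedBall 0 (R : ℝ))) := by
    rw [ae_all_iff]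
    intro R
    set ν : Measure (E n) := volume.restrict (Metric.closedBall 0 (R : ℝ)) with hν
    have hfin : ν Set.univ ≠ ∞ := by
      rw [hν, Measure.restrict_apply_univ]
      exact (isCompact_closedBall _ _).measure_ne_top
    have hm : AEMeasurable (fun ω => ‖g ω‖ₑ ^ r) μ := hg.1.enorm.pow_const r
    have h1 := hT.lintegral_lintegral ν hm
    have h2 : ∫⁻ ω, ‖g ω‖ₑ ^ r ∂μ ≠ ∞ := by
      have := lintegral_rpow_enorm_lt_top_of_eLpNorm_lt_top hr0 ENNReal.ofReal_ne_top hg.2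
      rw [ENNReal.toReal_ofReal hr.le] at this
      exact this.ne
    have h3 : ∀ᵐ ω ∂μ, ∫⁻ x, ‖g (T x ω)‖ₑ ^ r ∂ν < ∞ := by
      refine ae_lt_top' ?_ (by rw [h1]; exact ENNReal.mul_ne_top hfin h2)
      have h4 : AEMeasurable (fun z : Ω × E n => ‖g (T z.2 z.1)‖ₑ ^ r) (μ.prod ν) :=
        (hT.aestronglyMeasurable_uncurry_swap ν hg.1).enorm.pow_const r
      exact h4.lintegral_prod_right'
    filter_upwards [h3, hT.ae_aestronglyMeasurable ν hg.1] with ω h5 h6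
    refine ⟨h6, ?_⟩
    rw [eLpNorm_lt_top_iff_lintegral_rpow_enorm_lt_top hr0 ENNReal.ofReal_ne_top,
      ENNReal.toReal_ofReal hr.le]
    exact h5
  filter_upwards [key] with ω h K hK
  obtain ⟨R, hR⟩ := hK.isBounded.subset_closedBall 0
  obtain ⟨N, hN⟩ := exists_nat_ge R
  exact (h N).mono_measure (Measure.restrict_mono
    (hR.trans (Metric.closedBall_subset_closedBall hN)) le_rfl)

end Dynamics

/-! ### Almost everywhere convergence of minimizing sequences -/

section Minimizing

variable {F : Type*} [NormedAddCommGroup F]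

/-- A strictly convex function of linear growth. -/
noncomputable def bracket (a : F) : ℝ := √(1 + ‖a‖ ^ 2)

theorem bracket_nonneg (a : F) : 0 ≤ bracket a := Real.sqrt_nonneg _

theorem bracket_sq (a : F) : bracket a ^ 2 = 1 + ‖a‖ ^ 2 := Real.sq_sqrt (by positivity)

theorem bracket_le (a : F) : bracket a ≤ 1 + ‖a‖ :=
  Real.sqrt_le_iff.2 ⟨by positivity, by nlinarith [norm_nonneg a]⟩

theorem one_le_bracket (a : F) : 1 ≤ bracket a := by
  nlinarith [bracket_sq a, bracket_nonneg a, sq_nonneg ‖a‖]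

theorem norm_le_bracket (a : F) : ‖a‖ ≤ bracket a :=
  abs_le_of_sq_le_sq' (by rw [bracket_sq]; linarith) (bracket_nonneg a) |>.2

theorem continuous_bracket : Continuous (bracket : F → ℝ) := by
  unfold bracket; fun_prop

variable {Ω : Type*} [MeasurableSpace Ω] {μ : Measure Ω}

/-- A sequence whose increments are summable in `L^{1/2}` converges almost everywhere. -/
theorem exists_tendsto_of_tsum_lintegral_sqrt [CompleteSpace F] {w : ℕ → Ω → F}
    (hw : ∀ k, AEStronglyMeasurable (w k) μ)
    (h : ∑' k, ∫⁻ ω, ‖w k ω - w (k + 1) ω‖ₑ ^ (1 / 2 : ℝ) ∂μ ≠ ∞) :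
    ∃ w' : Ω → F, ∀ᵐ ω ∂μ, Tendsto (fun k => w k ω) atTop (𝓝 (w' ω)) := by
  have hm : ∀ k, AEMeasurable (fun ω => ‖w k ω - w (k + 1) ω‖ₑ ^ (1 / 2 : ℝ)) μ := fun k =>
    ((hw k).sub (hw (k + 1))).enorm.pow_const _
  rw [← lintegral_tsum hm] at h
  have h1 := ae_lt_top' (AEMeasurable.tsum hm) h
  have h2 : ∀ᵐ ω ∂μ, ∃ l, Tendsto (fun k => w k ω) atTop (𝓝 l) := by
    filter_upwards [h1] with ω hω
    apply cauchySeq_tendsto_of_complete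
    refine cauchySeq_of_edist_le_of_tsum_ne_top (fun k => ‖w k ω - w (k + 1) ω‖ₑ)
      (fun k => by rw [edist_eq_enorm_sub]) ?_
    set x : ℕ → ℝ≥0∞ := fun k => ‖w k ω - w (k + 1) ω‖ₑ with hx
    set S := ∑' k, x k ^ (1 / 2 : ℝ) with hS
    -- Each square root is at most their sum `S`, so `x k ≤ S √(x k)`, and summation gives `∑ x k ≤
    -- S²`.
    have h3 : ∀ k, x k ≤ S * x k ^ (1 / 2 : ℝ) := fun k => by
      calc x k = x k ^ (1 / 2 : ℝ) * x k ^ (1 / 2 : ℝ) := by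
            rw [← ENNReal.rpow_add_of_nonneg _ _ (by norm_num) (by norm_num)]; norm_num
        _ ≤ S * x k ^ (1 / 2 : ℝ) := by
            gcongr; exact ENNReal.le_tsum k
    refine ne_top_of_le_ne_top (ENNReal.mul_ne_top hω.ne hω.ne) (b := S * S) ?_
    rw [hS, ← ENNReal.tsum_mul_left]
    exact ENNReal.tsum_le_tsum h3
  choose! w' hw' using fun ω (h : ∃ l, Tendsto (fun k => w k ω) atTop (𝓝 l)) => h
  exact ⟨w', h2.mono hw'⟩

theorem integrable_bracket [IsFiniteMeasure μ] {w : Ω → F} (hw : Integrable w μ) :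
    Integrable (fun ω => bracket (w ω)) μ := by
  refine Integrable.mono' ((integrable_const (1 : ℝ)).add hw.norm)
    (continuous_bracket.comp_aestronglyMeasurable hw.1) (Eventually.of_forall fun ω => ?_)
  rw [Real.norm_eq_abs, abs_of_nonneg (bracket_nonneg _)]
  exact bracket_le _

variable [InnerProductSpace ℝ F]

/-- Quantitative strict convexity of `bracket`. -/
theorem norm_sub_sq_le_bracket (a b : F) :
    0 ≤ bracket a + bracket b - 2 * bracket ((1 / 2 : ℝ) • (a + b)) ∧
    ‖a - b‖ ^ 2 ≤ (bracket a + bracket b - 2 * bracket ((1 / 2 : ℝ) • (a + b))) *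
      (bracket a + bracket b) ^ 3 := by
  set A := bracket a with hA
  set B := bracket b with hB
  set M := bracket ((1 / 2 : ℝ) • (a + b)) with hM
  have hA1 : 1 ≤ A := one_le_bracket a
  have hB1 : 1 ≤ B := one_le_bracket b
  have hM1 : 1 ≤ M := one_le_bracket _
  have hA2 : A ^ 2 = 1 + ‖a‖ ^ 2 := bracket_sq a
  have hB2 : B ^ 2 = 1 + ‖b‖ ^ 2 := bracket_sq b
  have hM2 : 4 * M ^ 2 = 4 + ‖a + b‖ ^ 2 := by
    rw [hM, bracket_sq, norm_smul]; norm_num; ring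
  have hpar : ‖a + b‖ ^ 2 + ‖a - b‖ ^ 2 = 2 * (‖a‖ ^ 2 + ‖b‖ ^ 2) := by
    have := parallelogram_law_with_norm ℝ a b; nlinarith
  have ha : ‖a‖ ≤ A := norm_le_bracket a
  have hb : ‖b‖ ≤ B := norm_le_bracket b
  have hab : ‖a‖ * ‖b‖ ≤ A * B := mul_le_mul ha hb (norm_nonneg _) (by linarith)
  have hd : |‖a‖ - ‖b‖| ≤ ‖a - b‖ := abs_norm_sub_norm_le a b
  have hd2 : (‖a‖ - ‖b‖) ^ 2 ≤ ‖a - b‖ ^ 2 := by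
    rw [← sq_abs (‖a‖ - ‖b‖)]; gcongr
  have h1 : (A - B) ^ 2 * (A + B) ^ 2 ≤ ‖a - b‖ ^ 2 * (‖a‖ + ‖b‖) ^ 2 := by
    have : (A - B) * (A + B) = (‖a‖ - ‖b‖) * (‖a‖ + ‖b‖) := by nlinarith
    rw [← mul_pow, this, mul_pow]; gcongr
  have h2 : (‖a‖ + ‖b‖) ^ 2 ≤ (A + B) ^ 2 - 2 := by nlinarith
  -- Two parallelogram laws, one for `A, B` and one for `a, b`, turn the defect of the squares into
  -- `‖a - b‖² - (A - B)²`. By `h1` and `h2` the subtracted term is strictly smaller than `‖a - b‖²`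
  -- when `a ≠ b`, leaving the gap in `h4`.
  have h3 : ((A + B) ^ 2 - (2 * M) ^ 2) = ‖a - b‖ ^ 2 - (A - B) ^ 2 := by nlinarith
  have h4 : 2 * ‖a - b‖ ^ 2 ≤ ((A + B) ^ 2 - (2 * M) ^ 2) * (A + B) ^ 2 := by
    rw [h3]
    have := mul_le_mul_of_nonneg_left h2 (sq_nonneg ‖a - b‖)
    nlinarith
  have hS : 0 < (A + B) ^ 2 := by positivity
  have h5 : 0 ≤ (A + B) ^ 2 - (2 * M) ^ 2 := by
    by_contra h
    have := mul_neg_of_neg_of_pos (not_le.1 h) hS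
    nlinarith [sq_nonneg ‖a - b‖]
  have h6 : 2 * M ≤ A + B := abs_le_of_sq_le_sq' (by linarith) (by linarith) |>.2
  refine ⟨by linarith, ?_⟩
  have h7 : ((A + B) ^ 2 - (2 * M) ^ 2) ≤ (A + B - 2 * M) * (2 * (A + B)) := by
    have : ((A + B) ^ 2 - (2 * M) ^ 2) = (A + B - 2 * M) * (A + B + 2 * M) := by ring
    rw [this]
    exact mul_le_mul_of_nonneg_left (by linarith) (by linarith)
  have h8 := mul_le_mul_of_nonneg_right h7 hS.le
  nlinarith

/-- The distance in measure of two functions is controlled by the convexity defect. -/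
theorem lintegral_sqrt_enorm_sub_le [IsFiniteMeasure μ] {a b : Ω → F} (ha : Integrable a μ)
    (hb : Integrable b μ) :
    ∫⁻ ω, ‖a ω - b ω‖ₑ ^ (1 / 2 : ℝ) ∂μ ≤
      ENNReal.ofReal (∫ ω, bracket (a ω) ∂μ + ∫ ω, bracket (b ω) ∂μ
        - 2 * ∫ ω, bracket ((1 / 2 : ℝ) • (a ω + b ω)) ∂μ) ^ (1 / 4 : ℝ) *
      ENNReal.ofReal (∫ ω, bracket (a ω) ∂μ + ∫ ω, bracket (b ω) ∂μ) ^ (3 / 4 : ℝ) := by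
  have iA := integrable_bracket ha
  have iB := integrable_bracket hb
  have iM := integrable_bracket ((ha.add hb).smul (1 / 2 : ℝ))
  simp only [Pi.smul_apply, Pi.add_apply] at iM
  have iG : Integrable (fun ω => bracket (a ω) + bracket (b ω)
      - 2 * bracket ((1 / 2 : ℝ) • (a ω + b ω))) μ := (iA.add iB).sub (iM.const_mul 2)
  have iS : Integrable (fun ω => bracket (a ω) + bracket (b ω)) μ := iA.add iB
  have e1 : ∫ ω, bracket (a ω) ∂μ + ∫ ω, bracket (b ω) ∂μ
      = ∫ ω, (bracket (a ω) + bracket (b ω)) ∂μ := (integral_add iA iB).symm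
  have e2 : ∫ ω, bracket (a ω) ∂μ + ∫ ω, bracket (b ω) ∂μ
      - 2 * ∫ ω, bracket ((1 / 2 : ℝ) • (a ω + b ω)) ∂μ
      = ∫ ω, (bracket (a ω) + bracket (b ω) - 2 * bracket ((1 / 2 : ℝ) • (a ω + b ω))) ∂μ := by
    rw [e1, ← integral_const_mul]
    exact (integral_sub iS (iM.const_mul 2)).symm
  rw [e2, e1, ofReal_integral_eq_lintegral_ofReal iG
      (Eventually.of_forall fun ω => (norm_sub_sq_le_bracket _ _).1),
    ofReal_integral_eq_lintegral_ofReal iS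
      (Eventually.of_forall fun ω => add_nonneg (bracket_nonneg _) (bracket_nonneg _))]
  -- The fourth root of the pointwise bound reads `‖a - b‖^(1/2) ≤ defect^(1/4) · sum^(3/4)`, whose
  -- exponents are exactly those of Hölder's inequality. This is why the distance uses the power
  -- `1/2`.
  refine le_trans (lintegral_mono fun ω => ?_)
    (ENNReal.lintegral_mul_norm_pow_le iG.1.aemeasurable.ennreal_ofReal
      iS.1.aemeasurable.ennreal_ofReal (by norm_num) (by norm_num) (by norm_num))
  obtain ⟨h0, h⟩ := norm_sub_sq_le_bracket (a ω) (b ω)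
  have hS : 0 ≤ bracket (a ω) + bracket (b ω) := add_nonneg (bracket_nonneg _) (bracket_nonneg _)
  rw [← ofReal_norm, ENNReal.ofReal_rpow_of_nonneg (norm_nonneg _) (by norm_num),
    ENNReal.ofReal_rpow_of_nonneg h0 (by norm_num), ENNReal.ofReal_rpow_of_nonneg hS (by norm_num),
    ← ENNReal.ofReal_mul (by positivity)]
  apply ENNReal.ofReal_le_ofReal
  have := Real.rpow_le_rpow (by positivity) h (show (0 : ℝ) ≤ 1 / 4 by norm_num)
  rw [Real.mul_rpow h0 (by positivity), ← Real.rpow_natCast, ← Real.rpow_natCast,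
    ← Real.rpow_mul (norm_nonneg _), ← Real.rpow_mul hS] at this
  norm_num at this ⊢
  exact this

/-- Near-minimizers of `∫ bracket` on a decreasing sequence of convex sets bounded in `L¹`
converge almost everywhere along a subsequence. -/
theorem exists_nearMinimizer_tendsto [IsFiniteMeasure μ] [CompleteSpace F]
    {C : ℕ → Set (Ω → F)} (hanti : Antitone C) (hne : ∀ k, (C k).Nonempty)
    (hconv : ∀ k, ∀ a ∈ C k, ∀ b ∈ C k, (fun ω => (1 / 2 : ℝ) • (a ω + b ω)) ∈ C k)
    (hint : ∀ w ∈ C 0, Integrable w μ) {M : ℝ} (hM : ∀ w ∈ C 0, ∫ ω, ‖w ω‖ ∂μ ≤ M) :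
    ∃ (w : ℕ → Ω → F) (φ : ℕ → ℕ) (w' : Ω → F), StrictMono φ ∧ (∀ k, w k ∈ C k) ∧
      (∀ k, ∀ z ∈ C k, ∫ ω, bracket (w k ω) ∂μ ≤ ∫ ω, bracket (z ω) ∂μ + 1 / ((k : ℝ) + 1)) ∧
      ∀ᵐ ω ∂μ, Tendsto (fun k => w (φ k) ω) atTop (𝓝 (w' ω)) := by
  set J : (Ω → F) → ℝ := fun w => ∫ ω, bracket (w ω) ∂μ with hJ
  have hJ0 : ∀ w, 0 ≤ J w := fun w => integral_nonneg fun ω => bracket_nonneg _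
  have hsub : ∀ k, C k ⊆ C 0 := fun k => hanti (Nat.zero_le k)
  set B : ℝ := μ.real Set.univ + M with hB
  have hJB : ∀ w ∈ C 0, J w ≤ B := fun w hw => by
    calc J w ≤ ∫ ω, (1 + ‖w ω‖) ∂μ := integral_mono (integrable_bracket (hint w hw))
          ((integrable_const _).add (hint w hw).norm) fun ω => bracket_le _
      _ = μ.real Set.univ + ∫ ω, ‖w ω‖ ∂μ := by
          rw [integral_add (integrable_const _) (hint w hw).norm]; simp
      _ ≤ B := by rw [hB]; gcongr; exact hM w hw
  have hbdd : ∀ k, BddBelow (J '' C k) := fun k => ⟨0, by rintro _ ⟨w, -, rfl⟩; exact hJ0 w⟩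
  set I : ℕ → ℝ := fun k => sInf (J '' C k) with hI
  have hIle : ∀ k, ∀ z ∈ C k, I k ≤ J z := fun k z hz => csInf_le (hbdd k) ⟨z, hz, rfl⟩
  have hImono : Monotone I := fun i j hij =>
    csInf_le_csInf (hbdd i) ((hne j).image J) (Set.image_mono (hanti hij))
  have hIB : BddAbove (Set.range I) := by
    refine ⟨B, ?_⟩
    rintro _ ⟨k, rfl⟩
    obtain ⟨z, hz⟩ := hne k
    exact (hIle k z hz).trans (hJB z (hsub k hz))
  have hsel : ∀ k : ℕ, ∃ w ∈ C k, J w < I k + 1 / ((k : ℝ) + 1) := fun k => by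
    obtain ⟨_, ⟨w, hw, rfl⟩, h⟩ := exists_lt_of_csInf_lt ((hne k).image J)
      (lt_add_of_pos_right (I k) (show (0 : ℝ) < 1 / ((k : ℝ) + 1) by positivity))
    exact ⟨w, hw, h⟩
  choose w hwC hwJ using hsel
  set L := ⨆ k, I k with hL
  have hlim : Tendsto I atTop (𝓝 L) := tendsto_atTop_ciSup hImono hIB
  set e : ℕ → ℝ≥0∞ := fun k =>
    ENNReal.ofReal (L - I k + 2 * (1 / ((k : ℝ) + 1))) ^ (1 / 4 : ℝ) *
      ENNReal.ofReal (B + B) ^ (3 / 4 : ℝ) with he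
  -- The midpoint of `w k` and `w j` lies in `C k`, so its energy is at least `I k`. The convexity
  -- defect is thus at most `(I k + 1/(k+1)) + (L + 1/(j+1)) - 2 I k`, which is small because `I`
  -- increases to `L`.
  have hgap : ∀ k j, k ≤ j → ∫⁻ ω, ‖w k ω - w j ω‖ₑ ^ (1 / 2 : ℝ) ∂μ ≤ e k := by
    intro k j hkj
    have hjk : w j ∈ C k := hanti hkj (hwC j)
    refine (lintegral_sqrt_enorm_sub_le (hint _ (hsub k (hwC k)))
      (hint _ (hsub j (hwC j)))).trans ?_
    have h1 := hIle k _ (hconv k _ (hwC k) _ hjk)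
    have h2 := hwJ k
    have h3 := hwJ j
    have h4 : I j ≤ L := le_ciSup hIB j
    have h5 : 1 / ((j : ℝ) + 1) ≤ 1 / ((k : ℝ) + 1) := by gcongr
    have h6 := hJB _ (hsub k (hwC k))
    have h7 := hJB _ (hsub k hjk)
    simp only [hJ] at h1 h2 h3 h6 h7
    simp only [he]
    gcongr
    linarith
  have he0 : Tendsto e atTop (𝓝 0) := by
    have h1 : Tendsto (fun k : ℕ => L - I k + 2 * (1 / ((k : ℝ) + 1))) atTop (𝓝 0) := by
      have := (hlim.const_sub L).add (tendsto_one_div_add_atTop_nhds_zero_nat.const_mul (2 : ℝ))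
      simpa using this
    have h2 : Tendsto (fun k : ℕ => ENNReal.ofReal (L - I k + 2 * (1 / ((k : ℝ) + 1)))
        ^ (1 / 4 : ℝ)) atTop (𝓝 0) := by
      have := (ENNReal.continuous_rpow_const (y := 1 / 4)).tendsto 0 |>.comp
        ((ENNReal.tendsto_ofReal h1).trans (by simp))
      simpa [Function.comp_def] using this
    have h3 := ENNReal.Tendsto.mul_const (b := ENNReal.ofReal (B + B) ^ (3 / 4 : ℝ)) h2
      (Or.inr (ENNReal.rpow_ne_top_of_nonneg (by norm_num) ENNReal.ofReal_ne_top))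
    simpa [he] using h3
  have hev : ∀ m : ℕ, ∀ᶠ k in atTop, e k ≤ (2⁻¹ : ℝ≥0∞) ^ m := fun m =>
    he0.eventually (Iic_mem_nhds (ENNReal.pow_pos (by simp) m))
  obtain ⟨φ, hφ, hφe⟩ := extraction_forall_of_eventually hev
  obtain ⟨w', hw'⟩ := exists_tendsto_of_tsum_lintegral_sqrt (w := fun k => w (φ k))
    (fun k => (hint _ (hsub _ (hwC _))).1) (μ := μ) (by
      refine ne_top_of_le_ne_top ?_ (ENNReal.tsum_le_tsum fun k =>
        (hgap (φ k) (φ (k + 1)) (hφ.monotone k.le_succ)).trans (hφe k))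
      rw [ENNReal.tsum_geometric]
      simp)
  refine ⟨w, φ, w', hφ, hwC, fun k z hz => ?_, hw'⟩
  have := hIle k z hz
  have := (hwJ k).le
  simp only [hJ] at *
  linarith

end Minimizing

/-! ### Limits of bounded sequences in `L^r` -/

section WeakLimits

variable {Ω : Type*} [MeasurableSpace Ω] {μ : Measure Ω}
  {F G H : Type*} [NormedAddCommGroup F] [NormedAddCommGroup G] [NormedAddCommGroup H]

/-- Fatou's lemma: the norm is lower semicontinuous under almost everywhere convergence. -/
theorem memLp_of_tendsto_ae {r M : ℝ≥0∞} (hM : M ≠ ∞) {w : ℕ → Ω → F} {w' : Ω → F}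
    (hw : ∀ k, AEStronglyMeasurable (w k) μ) (hb : ∀ k, eLpNorm (w k) r μ ≤ M)
    (hlim : ∀ᵐ ω ∂μ, Tendsto (fun k => w k ω) atTop (𝓝 (w' ω))) : MemLp w' r μ := by
  refine ⟨aestronglyMeasurable_of_tendsto_ae atTop hw hlim, ?_⟩
  refine (Lp.eLpNorm_lim_le_liminf_eLpNorm hw w' hlim).trans_lt (lt_of_le_of_lt ?_ hM.lt_top)
  exact (liminf_le_liminf (Eventually.of_forall hb)).trans (by simp)

/-- Products of an `L^P` function with a bounded sequence in `L^Q` are uniformly integrable. -/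
theorem unifIntegrable_of_norm_le_mul {P Q M : ℝ≥0∞} [P.HolderConjugate Q] (hP : P ≠ ∞)
    (hM : M ≠ ∞) {u : Ω → F} (hu : MemLp u P μ) {w : ℕ → Ω → G} {g : ℕ → Ω → H}
    (hw : ∀ k, AEStronglyMeasurable (w k) μ) (hb : ∀ k, eLpNorm (w k) Q μ ≤ M)
    (hg : ∀ k ω, ‖g k ω‖ ≤ ‖u ω‖ * ‖w k ω‖) : UnifIntegrable g 1 μ := by
  have hP1 : 1 ≤ P := ENNReal.HolderConjugate.one_le P Q
  intro ε hε
  -- The added `1` allows division by `m` when `M = 0`.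
  set m : ℝ := M.toReal + 1 with hm
  have hm0 : 0 < m := by positivity
  obtain ⟨δ, hδ, h⟩ := hu.eLpNorm_indicator_le hP1 hP (div_pos hε hm0)
  refine ⟨δ, hδ, fun k s hs hμs => ?_⟩
  have h1 : eLpNorm (s.indicator (g k)) 1 μ ≤
      eLpNorm (fun ω => ‖s.indicator u ω‖ * ‖w k ω‖) 1 μ := by
    refine eLpNorm_mono fun ω => ?_
    by_cases hω : ω ∈ s
    · simpa [hω] using hg k ω
    · simp [hω]
  have h2 := eLpNorm_le_eLpNorm_mul_eLpNorm'_of_norm (r := 1) (p := P) (q := Q)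
    (hu.1.indicator hs) (hw k) (fun a b => ‖a‖ * ‖b‖) 1
    (Eventually.of_forall fun ω => by simp)
  refine (h1.trans h2).trans ?_
  calc ((1 : NNReal) : ℝ≥0∞) * eLpNorm (s.indicator u) P μ * eLpNorm (w k) Q μ
      ≤ 1 * ENNReal.ofReal (ε / m) * ENNReal.ofReal m := by
        gcongr
        · simp
        · exact h s hs hμs
        · refine (hb k).trans ?_
          rw [← ENNReal.ofReal_toReal hM]
          exact ENNReal.ofReal_le_ofReal (by simp [hm])
    _ = ENNReal.ofReal ε := by
        rw [one_mul, ← ENNReal.ofReal_mul (by positivity), div_mul_cancel₀ _ hm0.ne']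

/-- Vitali's theorem: a bound in `L^Q` with `Q > 1` gives uniform integrability, by Hölder against
the constant `1`. -/
theorem tendsto_eLpNorm_one_sub [IsFiniteMeasure μ] {Q M : ℝ≥0∞} (hQ : 1 < Q) (hM : M ≠ ∞)
    {w : ℕ → Ω → F} {w' : Ω → F}
    (hw : ∀ k, AEStronglyMeasurable (w k) μ) (hb : ∀ k, eLpNorm (w k) Q μ ≤ M)
    (hlim : ∀ᵐ ω ∂μ, Tendsto (fun k => w k ω) atTop (𝓝 (w' ω))) :
    Tendsto (fun k => eLpNorm (w k - w') 1 μ) atTop (𝓝 0) := by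
  have hP : ENNReal.HolderConjugate (Q.conjExponent) Q :=
    (ENNReal.HolderConjugate.conjExponent hQ.le).symm
  have hPtop : Q.conjExponent ≠ ∞ := (ENNReal.HolderConjugate.lt_top_iff_one_lt _ Q).2 hQ |>.ne
  have hmem := memLp_of_tendsto_ae hM hw hb hlim
  refine tendsto_Lp_finite_of_tendsto_ae le_rfl ENNReal.one_ne_top hw (hmem.mono_exponent hQ.le)
    (unifIntegrable_of_norm_le_mul (u := fun _ => (1 : ℝ)) hPtop hM (memLp_const 1) hw hb ?_) hlim
  intro k ω
  simp

theorem tendsto_integral_of_bounded [IsFiniteMeasure μ] [NormedSpace ℝ F] {Q M : ℝ≥0∞}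
    (hQ : 1 < Q) (hM : M ≠ ∞) {w : ℕ → Ω → F} {w' : Ω → F}
    (hw : ∀ k, AEStronglyMeasurable (w k) μ) (hb : ∀ k, eLpNorm (w k) Q μ ≤ M)
    (hlim : ∀ᵐ ω ∂μ, Tendsto (fun k => w k ω) atTop (𝓝 (w' ω))) :
    Tendsto (fun k => ∫ ω, w k ω ∂μ) atTop (𝓝 (∫ ω, w' ω ∂μ)) :=
  tendsto_integral_of_L1' w' (memLp_of_tendsto_ae hM hw hb hlim).1
    (Eventually.of_forall fun k =>
      MemLp.integrable hQ.le ⟨hw k, (hb k).trans_lt hM.lt_top⟩)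
    (tendsto_eLpNorm_one_sub hQ hM hw hb hlim)

theorem integrable_inner_of_memLp [InnerProductSpace ℝ F] {P Q : ℝ≥0∞} [P.HolderConjugate Q]
    {u v : Ω → F} (hu : MemLp u P μ) (hv : MemLp v Q μ) :
    Integrable (fun ω => inner ℝ (u ω) (v ω)) μ := by
  refine memLp_one_iff_integrable.1 ⟨hu.1.inner (𝕜 := ℝ) hv.1, ?_⟩
  refine (eLpNorm_le_eLpNorm_mul_eLpNorm'_of_norm (p := P) (q := Q) hu.1 hv.1
    (fun a b => inner ℝ a b) 1 (Eventually.of_forall fun ω => ?_)).trans_lt ?_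
  · simpa using norm_inner_le_norm (𝕜 := ℝ) (u ω) (v ω)
  · simpa using ENNReal.mul_lt_top hu.2 hv.2

/-- Almost everywhere convergence of a bounded sequence in `L^Q` implies weak convergence. -/
theorem tendsto_integral_inner [IsFiniteMeasure μ] [InnerProductSpace ℝ F] {P Q M : ℝ≥0∞}
    [P.HolderConjugate Q] (hP : P ≠ ∞) (hM : M ≠ ∞) {u : Ω → F} (hu : MemLp u P μ)
    {w : ℕ → Ω → F} {w' : Ω → F}
    (hw : ∀ k, AEStronglyMeasurable (w k) μ) (hb : ∀ k, eLpNorm (w k) Q μ ≤ M)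
    (hlim : ∀ᵐ ω ∂μ, Tendsto (fun k => w k ω) atTop (𝓝 (w' ω))) :
    Tendsto (fun k => ∫ ω, inner ℝ (u ω) (w k ω) ∂μ) atTop
      (𝓝 (∫ ω, inner ℝ (u ω) (w' ω) ∂μ)) := by
  have hw' := integrable_inner_of_memLp hu (memLp_of_tendsto_ae hM hw hb hlim)
  refine tendsto_integral_of_L1' _ hw'.1 (Eventually.of_forall fun k =>
    integrable_inner_of_memLp hu ⟨hw k, (hb k).trans_lt hM.lt_top⟩) ?_
  refine tendsto_Lp_finite_of_tendsto_ae le_rfl ENNReal.one_ne_top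
    (fun k => hu.1.inner (𝕜 := ℝ) (hw k)) (memLp_one_iff_integrable.2 hw')
    (unifIntegrable_of_norm_le_mul hP hM hu hw hb fun k ω => norm_inner_le_norm (𝕜 := ℝ) _ _) ?_
  filter_upwards [hlim] with ω hω
  exact tendsto_const_nhds.inner hω

end WeakLimits

/-! ### Convolution with test functions -/

section Convolution

open scoped Convolution

variable {n : ℕ}

theorem IsTest.continuous {φ : E n → ℝ} (hφ : IsTest φ) : Continuous φ := hφ.1.continuous

theorem IsTest.differentiable {φ : E n → ℝ} (hφ : IsTest φ) : Differentiable ℝ φ :=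
  hφ.1.differentiable (by simp)

theorem IsTest.partialDeriv {φ : E n → ℝ} (hφ : IsTest φ) (i : Fin n) :
    IsTest (partialDeriv i φ) := by
  refine ⟨?_, ?_⟩
  · exact (hφ.1.fderiv_right (m := ((⊤ : ℕ∞) : WithTop ℕ∞)) (by simp)).clm_apply contDiff_const
  · exact hφ.2.fderiv_apply (𝕜 := ℝ) _

theorem IsTest.comp_add_right {φ : E n → ℝ} (hφ : IsTest φ) (h : E n) :
    IsTest (fun x => φ (x + h)) :=
  ⟨hφ.1.comp (contDiff_id.add contDiff_const), hφ.2.comp_homeomorph (Homeomorph.addRight h)⟩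

theorem IsTest.comp_sub_left {φ : E n → ℝ} (hφ : IsTest φ) (h : E n) :
    IsTest (fun x => φ (h - x)) :=
  ⟨hφ.1.comp (contDiff_const.sub contDiff_id), hφ.2.comp_homeomorph (Homeomorph.subLeft h)⟩

theorem partialDeriv_comp_add_right (φ : E n → ℝ) (h : E n) (i : Fin n) (x : E n) :
    partialDeriv i (fun y => φ (y + h)) x = partialDeriv i φ (x + h) := by
  simp only [partialDeriv, fderiv_comp_add_right]

theorem partialDeriv_comp_sub_left {φ : E n → ℝ} (hφ : Differentiable ℝ φ) (h : E n) (i : Fin n)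
    (x : E n) : partialDeriv i (fun y => φ (h - y)) x = -partialDeriv i φ (h - x) := by
  have h1 := (hφ (h - x)).hasFDerivAt.comp x ((hasFDerivAt_id (𝕜 := ℝ) x).const_sub h)
  have h2 : fderiv ℝ (fun y => φ (h - y)) x = _ := h1.fderiv
  simp [partialDeriv, h2]

/-- Integration by parts against the constant `1`. -/
theorem integral_partialDeriv_eq_zero {φ : E n → ℝ} (hφ : IsTest φ) (i : Fin n) :
    ∫ x, partialDeriv i φ x = 0 := by
  have h := integral_mul_fderiv_eq_neg_fderiv_mul_of_integrable (𝕜 := ℝ)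
    (μ := (volume : Measure (E n))) (f := fun _ : E n => (1 : ℝ)) (g := φ)
    (v := EuclideanSpace.single i 1) (by simp)
    (by
      simp only [one_mul]
      exact (hφ.partialDeriv i).continuous.integrable_of_hasCompactSupport (hφ.partialDeriv i).2)
    (by
      simp only [one_mul]
      exact hφ.continuous.integrable_of_hasCompactSupport hφ.2)
    (by simp) (fun x _ => hφ.differentiable x)
  simpa [partialDeriv] using h

theorem MemLpLoc.locallyIntegrable {r : ℝ} (hr : 1 ≤ r) {V : E n → E n} (hV : MemLpLoc r V) :
    LocallyIntegrable V := by
  rw [locallyIntegrable_iff]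
  intro K hK
  have : IsFiniteMeasure (volume.restrict K) := ⟨by
    rw [Measure.restrict_apply_univ]; exact hK.measure_lt_top⟩
  exact (hV K hK).integrable (by simpa using hr)

theorem locallyIntegrable_coord {V : E n → E n} (hV : LocallyIntegrable V) (i : Fin n) :
    LocallyIntegrable (fun x => V x i) := by
  rw [locallyIntegrable_iff] at hV ⊢
  intro K hK
  exact (EuclideanSpace.proj (𝕜 := ℝ) i).integrable_comp (hV K hK)

theorem integrable_test_mul {φ V : E n → ℝ} (hφ : Continuous φ) (hφc : HasCompactSupport φ)
    (hV : LocallyIntegrable V) : Integrable (fun x => V x * φ x) := by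
  simpa [mul_comm] using hV.integrable_smul_left_of_hasCompactSupport hφ hφc

theorem contDiff_convolution_test {ρ V : E n → ℝ} (hρ : IsTest ρ) (hV : LocallyIntegrable V) :
    ContDiff ℝ ((⊤ : ℕ∞) : WithTop ℕ∞) (ρ ⋆[ContinuousLinearMap.lsmul ℝ ℝ, volume] V) :=
  hρ.2.contDiff_convolution_left _ hρ.1 hV

theorem partialDeriv_convolution {ρ V : E n → ℝ} (hρ : IsTest ρ) (hV : LocallyIntegrable V)
    (i : Fin n) (x : E n) :
    partialDeriv i (ρ ⋆[ContinuousLinearMap.lsmul ℝ ℝ, volume] V) x =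
      (partialDeriv i ρ ⋆[ContinuousLinearMap.lsmul ℝ ℝ, volume] V) x := by
  have h1 : ContDiff ℝ 1 ρ := hρ.1.of_le (by exact_mod_cast le_top)
  have h := hρ.2.hasFDerivAt_convolution_left (ContinuousLinearMap.lsmul ℝ ℝ) h1 hV x
  have hex := (hρ.2.fderiv (𝕜 := ℝ)).convolutionExists_left
    ((ContinuousLinearMap.lsmul ℝ ℝ : ℝ →L[ℝ] ℝ →L[ℝ] ℝ).precompL (E n))
    (h1.continuous_fderiv one_ne_zero) hV x
  rw [partialDeriv, h.fderiv, convolution_def, ContinuousLinearMap.integral_apply hex]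
  rfl

/-- A potential field has symmetric mollified derivative. -/
theorem IsPotential.convolution_symm {r : ℝ} {V : E n → E n} (hV : IsPotential r V)
    (hr : 1 ≤ r) {ρ : E n → ℝ} (hρ : IsTest ρ) (i j : Fin n) (x : E n) :
    (partialDeriv j ρ ⋆[ContinuousLinearMap.lsmul ℝ ℝ, volume] fun y => V y i) x =
      (partialDeriv i ρ ⋆[ContinuousLinearMap.lsmul ℝ ℝ, volume] fun y => V y j) x := by
  have hloc := hV.1.locallyIntegrable hr
  -- Testing with `ρ (x - ·)` produces the convolutions at `x`; the signs from differentiating the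
  -- reflection cancel.
  have h := hV.2 i j _ (hρ.comp_sub_left x)
  have hint : ∀ k l, Integrable (fun y => V y k * partialDeriv l (fun z => ρ (x - z)) y) :=
    fun k l => integrable_test_mul ((hρ.comp_sub_left x).partialDeriv l).continuous
      ((hρ.comp_sub_left x).partialDeriv l).2 (locallyIntegrable_coord hloc k)
  rw [integral_sub (hint i j) (hint j i), sub_eq_zero] at h
  simp only [partialDeriv_comp_sub_left hρ.differentiable, mul_neg, integral_neg, neg_inj] at h
  rw [convolution_eq_swap, convolution_eq_swap]
  simpa [mul_comm] using h

/-- Integration by parts of a solenoidal field against a smooth gradient. -/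
theorem IsSolenoidal.integral_mul_partialDeriv {r : ℝ} {U : E n → E n} (hU : IsSolenoidal r U)
    (hr : 1 ≤ r) {χ Z : E n → ℝ} (hχ : IsTest χ) (hZ : ContDiff ℝ ((⊤ : ℕ∞) : WithTop ℕ∞) Z) :
    ∫ x, χ x * ∑ i, U x i * partialDeriv i Z x =
      -∑ i, ∫ x, partialDeriv i χ x * (U x i * Z x) := by
  have hloc := hU.1.locallyIntegrable hr
  have hprod : IsTest (fun x => χ x * Z x) := ⟨hχ.1.mul hZ, hχ.2.mul_right⟩
  have hZd : Differentiable ℝ Z := hZ.differentiable (by simp)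
  have hZ' : ∀ i, Continuous (partialDeriv i Z) := fun i =>
    ((hZ.fderiv_right (m := ((⊤ : ℕ∞) : WithTop ℕ∞)) (by simp)).clm_apply contDiff_const).continuous
  have hd : ∀ i x, partialDeriv i (fun x => χ x * Z x) x =
      χ x * partialDeriv i Z x + partialDeriv i χ x * Z x := fun i x => by
    have := ((hχ.differentiable x).hasFDerivAt.mul (hZd x).hasFDerivAt).fderiv
    simp only [partialDeriv]
    change fderiv ℝ (χ * Z) x _ = _
    rw [this]
    simp [mul_comm]
  have i1 : ∀ i, Integrable (fun x => U x i * (χ x * partialDeriv i Z x)) := fun i =>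
    integrable_test_mul (hχ.continuous.mul (hZ' i)) hχ.2.mul_right (locallyIntegrable_coord hloc i)
  have i2 : ∀ i, Integrable (fun x => U x i * (partialDeriv i χ x * Z x)) := fun i =>
    integrable_test_mul ((hχ.partialDeriv i).continuous.mul hZ.continuous)
      (hχ.partialDeriv i).2.mul_right (locallyIntegrable_coord hloc i)
  have h := hU.2 _ hprod
  simp only [hd, mul_add] at h
  simp_rw [fun i => integral_add (i1 i) (i2 i)] at h
  rw [Finset.sum_add_distrib] at h
  have e1 : ∫ x, χ x * ∑ i, U x i * partialDeriv i Z x =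
      ∑ i, ∫ x, U x i * (χ x * partialDeriv i Z x) := by
    rw [← integral_finsetSum _ fun i _ => i1 i]
    congr 1; ext x
    rw [Finset.mul_sum]
    exact Finset.sum_congr rfl fun i _ => by ring
  have e2 : ∑ i, ∫ x, partialDeriv i χ x * (U x i * Z x) =
      ∑ i, ∫ x, U x i * (partialDeriv i χ x * Z x) :=
    Finset.sum_congr rfl fun i _ => by congr 1; ext x; ring
  rw [e1, e2]
  linarith

end Convolution

/-! ### Averages along orbits -/

section OrbitAverage

open scoped Convolution

variable {n : ℕ} {Ω : Type*} [MeasurableSpace Ω] {μ : Measure Ω} {T : E n → Ω → Ω}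

theorem IsDynamicalSystem.aestronglyMeasurable_uncurry_neg [SFinite μ]
    (hT : IsDynamicalSystem μ T) (ν : Measure (E n)) [SFinite ν]
    {F : Type*} [TopologicalSpace F] {s : Ω → F} (hs : AEStronglyMeasurable s μ) :
    AEStronglyMeasurable (fun z : Ω × E n => s (T (-z.2) z.1)) (μ.prod ν) := by
  have h1 : Measure.QuasiMeasurePreserving (fun z : E n × Ω => (z.1, T (-z.1) z.2))
      (ν.prod μ) (ν.prod μ) :=
    ((MeasurePreserving.id ν).skew_product (g := fun x ω => T (-x) ω)
      (hT.measurable_uncurry.comp (measurable_fst.neg.prodMk measurable_snd))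
      (Eventually.of_forall fun x =>
        (hT.measurePreserving (-x)).map_eq)).quasiMeasurePreserving
  have h2 := hs.comp_quasiMeasurePreserving
    ((Measure.quasiMeasurePreserving_snd (μ := ν) (ν := μ)).comp h1)
  exact h2.comp_quasiMeasurePreserving
    (Measure.measurePreserving_swap (μ := μ) (ν := ν)).quasiMeasurePreserving

variable {F : Type*} [NormedAddCommGroup F] [NormedSpace ℝ F]

/-- The average of `s` along the orbits of `T`, with weight `ρ`. -/
noncomputable def orbitAvg (T : E n → Ω → Ω) (ρ : E n → ℝ) (s : Ω → F) (ω : Ω) : F :=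
  ∫ t, ρ t • s (T (-t) ω)

/-- The realizations of an orbit average are the mollified realizations. -/
theorem IsDynamicalSystem.orbitAvg_apply (hT : IsDynamicalSystem μ T) (ρ : E n → ℝ) (s : Ω → F)
    (x : E n) (ω : Ω) :
    orbitAvg T ρ s (T x ω) =
      (ρ ⋆[ContinuousLinearMap.lsmul ℝ ℝ, volume] fun y => s (T y ω)) x := by
  simp only [orbitAvg, convolution_def, ← hT.add, ContinuousLinearMap.lsmul_apply,
    neg_add_eq_sub]

/-- Moving along the orbit shifts the kernel. Translates of a mollified field are therefore covered
by statements about arbitrary test kernels. -/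
theorem IsDynamicalSystem.orbitAvg_comp (hT : IsDynamicalSystem μ T) (ρ : E n → ℝ) (s : Ω → F)
    (h : E n) (ω : Ω) :
    orbitAvg T ρ s (T h ω) = orbitAvg T (fun t => ρ (t + h)) s ω := by
  simp only [orbitAvg, ← hT.add]
  rw [← integral_add_right_eq_self _ h]
  simp

theorem integral_norm_mul_le {P Q : ℝ≥0∞} [P.HolderConjugate Q] {a s : Ω → ℝ} (ha : MemLp a P μ)
    (hs : MemLp s Q μ) :
    ∫ ω, ‖a ω * s ω‖ ∂μ ≤ (eLpNorm a P μ * eLpNorm s Q μ).toReal := by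
  have h := eLpNorm_le_eLpNorm_mul_eLpNorm'_of_norm (p := P) (q := Q) (r := 1) ha.1 hs.1
    (fun x y => x * y) 1 (Eventually.of_forall fun ω => by simp)
  change ∫ ω, ‖(a * s) ω‖ ∂μ ≤ _
  rw [integral_norm_eq_lintegral_enorm (ha.1.mul hs.1)]
  rw [eLpNorm_one_eq_lintegral_enorm] at h
  exact ENNReal.toReal_mono (ENNReal.mul_ne_top ha.2.ne hs.2.ne) (by simpa using h)

variable [SFinite μ]

theorem IsDynamicalSystem.aestronglyMeasurable_orbitAvg (hT : IsDynamicalSystem μ T)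
    {ρ : E n → ℝ} (hρ : Continuous ρ) {s : Ω → F} (hs : AEStronglyMeasurable s μ) :
    AEStronglyMeasurable (orbitAvg T ρ s) μ :=
  (hρ.aestronglyMeasurable.comp_snd.smul
    (hT.aestronglyMeasurable_uncurry_neg volume hs)).integral_prod_right'

/-- By Hölder and invariance, the `ω`-integral at fixed `t` is at most `|ρ t|` times a constant
independent of `t`. This justifies Fubini for correlations with orbit averages. -/
theorem IsDynamicalSystem.integrable_prod (hT : IsDynamicalSystem μ T) {P Q : ℝ≥0∞}
    [P.HolderConjugate Q] {a s : Ω → ℝ} (ha : MemLp a P μ) (hs : MemLp s Q μ) {ρ : E n → ℝ}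
    (hρ : Continuous ρ) (hρc : HasCompactSupport ρ) :
    Integrable (fun z : Ω × E n => a z.1 * (ρ z.2 * s (T (-z.2) z.1))) (μ.prod volume) := by
  have hm : AEStronglyMeasurable (fun z : Ω × E n => a z.1 * (ρ z.2 * s (T (-z.2) z.1)))
      (μ.prod volume) :=
    (ha.1.comp_fst).mul (hρ.aestronglyMeasurable.comp_snd.mul
      (hT.aestronglyMeasurable_uncurry_neg volume hs.1))
  have hst : ∀ t : E n, MemLp (fun ω => s (T (-t) ω)) Q μ := fun t => hT.memLp_comp (-t) hs
  rw [integrable_prod_iff' hm]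
  refine ⟨Eventually.of_forall fun t => ?_, ?_⟩
  · have := (ha.integrable_mul (hst t)).const_mul (ρ t)
    refine this.congr (Eventually.of_forall fun ω => ?_)
    simp only [Pi.mul_apply]; ring
  · set C := (eLpNorm a P μ * eLpNorm s Q μ).toReal
    refine Integrable.mono' ((hρ.integrable_of_hasCompactSupport hρc).norm.mul_const C)
      hm.norm.prod_swap.integral_prod_right' (Eventually.of_forall fun t => ?_)
    have h1 : ∀ ω, ‖a ω * (ρ t * s (T (-t) ω))‖ = ‖ρ t‖ * ‖a ω * s (T (-t) ω)‖ := fun ω => by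
      simp only [norm_mul]; ring
    simp only [h1, integral_const_mul]
    rw [norm_mul, norm_norm, Real.norm_of_nonneg (integral_nonneg fun _ => norm_nonneg _)]
    gcongr
    refine (integral_norm_mul_le ha (hst t)).trans (le_of_eq ?_)
    rw [hT.eLpNorm_comp (-t) hs.1]

theorem IsDynamicalSystem.integrable_mul_orbitAvg (hT : IsDynamicalSystem μ T) {P Q : ℝ≥0∞}
    [P.HolderConjugate Q] {a s : Ω → ℝ} (ha : MemLp a P μ) (hs : MemLp s Q μ) {ρ : E n → ℝ}
    (hρ : Continuous ρ) (hρc : HasCompactSupport ρ) :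
    Integrable (fun ω => a ω * orbitAvg T ρ s ω) μ := by
  have := (hT.integrable_prod ha hs hρ hρc).integral_prod_left
  simpa only [orbitAvg, smul_eq_mul, integral_const_mul] using this

theorem IsDynamicalSystem.integral_mul_orbitAvg (hT : IsDynamicalSystem μ T) {P Q : ℝ≥0∞}
    [P.HolderConjugate Q] {a s : Ω → ℝ} (ha : MemLp a P μ) (hs : MemLp s Q μ) {ρ : E n → ℝ}
    (hρ : Continuous ρ) (hρc : HasCompactSupport ρ) :
    ∫ ω, a ω * orbitAvg T ρ s ω ∂μ = ∫ t, ρ t * ∫ ω, a ω * s (T (-t) ω) ∂μ := by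
  have h := integral_integral_swap (f := fun ω t => a ω * (ρ t * s (T (-t) ω)))
    (hT.integrable_prod ha hs hρ hρc)
  simp only [orbitAvg, smul_eq_mul]
  simp only [integral_const_mul] at h
  rw [h]
  congr 1; ext t
  rw [← integral_const_mul]
  congr 1; ext ω; ring

/-- The spatial average of a stationary field has the same mean. -/
theorem IsDynamicalSystem.integral_integral_mul (hT : IsDynamicalSystem μ T) {K : Ω → ℝ}
    (hK : Integrable K μ) {χ : E n → ℝ} (hχ : Integrable χ) :
    Integrable (fun ω => ∫ x, χ x * K (T x ω)) μ ∧
      ∫ ω, (∫ x, χ x * K (T x ω)) ∂μ = (∫ x, χ x) * ∫ ω, K ω ∂μ := by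
  have h1 : Integrable (fun z : E n × Ω => χ z.1 * K z.2) (volume.prod μ) := hχ.mul_prod hK
  have hs := hT.measurePreserving_shear volume
  have h2 : Integrable (fun z : E n × Ω => χ z.1 * K (T z.1 z.2)) (volume.prod μ) :=
    (hs.integrable_comp h1.1).2 h1
  refine ⟨h2.integral_prod_right, ?_⟩
  rw [integral_integral_swap (f := fun ω x => χ x * K (T x ω)) h2.swap]
  have h3 : ∀ x, ∫ ω, χ x * K (T x ω) ∂μ = χ x * ∫ ω, K ω ∂μ := fun x => by
    rw [integral_const_mul, hT.integral_comp x hK.1]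
  simp only [h3, integral_mul_const]

end OrbitAverage

/-! ### The div-curl identity -/

section DivCurl

open scoped Convolution

variable {n : ℕ} {Ω : Type*} [MeasurableSpace Ω] {μ : Measure Ω} {T : E n → Ω → Ω}

theorem memLp_coord {g : Ω → E n} {r : ℝ≥0∞} (hg : MemLp g r μ) (i : Fin n) :
    MemLp (fun ω => g ω i) r μ :=
  (EuclideanSpace.proj (𝕜 := ℝ) i).comp_memLp' hg

variable [SFinite μ]

theorem exists_isTest_integral_eq_one : ∃ χ : E n → ℝ, IsTest χ ∧ ∫ x, χ x = 1 := by
  let φ : ContDiffBump (0 : E n) := ⟨1, 2, one_pos, one_lt_two⟩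
  exact ⟨φ.normed volume, ⟨φ.contDiff_normed, φ.hasCompactSupport_normed⟩, φ.integral_normed⟩

/-- A solenoidal field is orthogonal to the derivatives of a mollified potential field. -/
theorem IsDynamicalSystem.sum_integral_mul_orbitAvg_eq_zero (hT : IsDynamicalSystem μ T) {p q : ℝ}
    (hpq : p.HolderConjugate q) {u v : Ω → E n} (hu : u ∈ LpSol μ T p) (hv : v ∈ LpPot μ T q)
    {ρ : E n → ℝ} (hρ : IsTest ρ) (j : Fin n) :
    ∑ i, ∫ ω, u ω i * orbitAvg T (partialDeriv j ρ) (fun ω => v ω i) ω ∂μ = 0 := by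
  have := hpq.ennrealOfReal
  have hui := memLp_coord hu.1
  have hvi := memLp_coord hv.1
  have hρ' := hρ.partialDeriv
  set H : Ω → ℝ := fun ω => ∑ i, u ω i * orbitAvg T (partialDeriv i ρ) (fun ω => v ω j) ω with hH
  have hi : ∀ i, Integrable (fun ω => u ω i * orbitAvg T (partialDeriv i ρ) (fun ω => v ω j) ω) μ :=
    fun i => hT.integrable_mul_orbitAvg (hui i) (hvi j) (hρ' i).continuous (hρ' i).2
  have hHi : Integrable H μ := integrable_finsetSum _ fun i _ => hi i
  have hKi : ∀ i, Integrable (fun ω => u ω i * orbitAvg T ρ (fun ω => v ω j) ω) μ :=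
    fun i => hT.integrable_mul_orbitAvg (hui i) (hvi j) hρ.continuous hρ.2
  -- Vanishing curl exchanges the indices `i` and `j`, so that `u` is paired with the gradient of
  -- the mollified component `v_j`.
  have e1 : ∑ i, ∫ ω, u ω i * orbitAvg T (partialDeriv j ρ) (fun ω => v ω i) ω ∂μ =
      ∫ ω, H ω ∂μ := by
    rw [hH, integral_finsetSum _ fun i _ => hi i]
    refine Finset.sum_congr rfl fun i _ => integral_congr_ae ?_
    filter_upwards [hv.2] with ω hω
    have := hω.convolution_symm hpq.symm.lt.le hρ i j 0
    rw [← hT.orbitAvg_apply _ (fun ω => v ω i), ← hT.orbitAvg_apply _ (fun ω => v ω j),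
      hT.zero] at this
    simp only [this]
  obtain ⟨χ, hχ, hχ1⟩ := exists_isTest_integral_eq_one (n := n)
  have hχi := hχ.continuous.integrable_of_hasCompactSupport (μ := volume) hχ.2
  have e2 := (hT.integral_integral_mul hHi hχi).2
  rw [hχ1, one_mul] at e2
  rw [e1, ← e2]
  have hχ'i : ∀ i, Integrable (partialDeriv i χ) := fun i =>
    (hχ.partialDeriv i).continuous.integrable_of_hasCompactSupport (hχ.partialDeriv i).2
  -- Along almost every orbit the gradient is moved onto the cutoff `χ`. Taking expectations,
  -- stationarity factors out `∫ ∂_i χ = 0`.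
  have e3 : ∀ᵐ ω ∂μ, ∫ x, χ x * H (T x ω) = -∑ i, ∫ x, partialDeriv i χ x *
      (u (T x ω) i * orbitAvg T ρ (fun ω => v ω j) (T x ω)) := by
    filter_upwards [hu.2, hv.2] with ω hω hω'
    have hloc := locallyIntegrable_coord (hω'.1.locallyIntegrable hpq.symm.lt.le) j
    have h := hω.integral_mul_partialDeriv hpq.lt.le hχ (contDiff_convolution_test hρ hloc)
    simp only [partialDeriv_convolution hρ hloc] at h
    simp only [hH, hT.orbitAvg_apply]
    exact h
  rw [integral_congr_ae e3, integral_neg, integral_finsetSum _ fun i _ =>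
    (hT.integral_integral_mul (hKi i) (hχ'i i)).1]
  simp only [(hT.integral_integral_mul (hKi _) (hχ'i _)).2, integral_partialDeriv_eq_zero hχ,
    zero_mul, Finset.sum_const_zero, neg_zero]

theorem eq_of_partialDeriv_eq_zero {g : E n → ℝ} (hg : Differentiable ℝ g)
    (h : ∀ j x, partialDeriv j g x = 0) (x y : E n) : g x = g y := by
  refine is_const_of_fderiv_eq_zero hg (fun x => ?_) x y
  have := (EuclideanSpace.basisFun (Fin n) ℝ).toBasis.ext (f₁ := (fderiv ℝ g x : E n →ₗ[ℝ] ℝ))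
    (f₂ := 0) (fun j => by simpa [partialDeriv] using h j x)
  ext z
  exact LinearMap.congr_fun this z

/-- The correlation of a solenoidal field with translates of a mollified potential field is
constant. -/
theorem IsDynamicalSystem.sum_integral_mul_orbitAvg_comp (hT : IsDynamicalSystem μ T) {p q : ℝ}
    (hpq : p.HolderConjugate q) {u v : Ω → E n} (hu : u ∈ LpSol μ T p) (hv : v ∈ LpPot μ T q)
    {ρ : E n → ℝ} (hρ : IsTest ρ) (h : E n) :
    ∑ i, ∫ ω, u ω i * orbitAvg T ρ (fun ω => v ω i) (T h ω) ∂μ =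
      ∑ i, ∫ ω, u ω i * orbitAvg T ρ (fun ω => v ω i) ω ∂μ := by
  have := hpq.ennrealOfReal
  have hui := memLp_coord hu.1
  have hvi := memLp_coord hv.1
  set G : Fin n → E n → ℝ := fun i y => ∫ ω, u ω i * v (T y ω) i ∂μ with hG
  -- Hölder and invariance bound each correlation uniformly in `y`; its convolution with a test
  -- function is then smooth and can be differentiated.
  have hGloc : ∀ i, LocallyIntegrable (G i) := fun i => by
    refine MemLp.locallyIntegrable (p := ∞) (memLp_top_of_bound 
      (C := (eLpNorm (fun ω => u ω i) (ENNReal.ofReal p) μ *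
        eLpNorm (fun ω => v ω i) (ENNReal.ofReal q) μ).toReal)
      (((hui i).1.comp_snd).mul
        (hT.aestronglyMeasurable_uncurry volume (hvi i).1)).integral_prod_right'
      (Eventually.of_forall fun y => ?_)) (by simp)
    refine (norm_integral_le_integral_norm _).trans
      ((integral_norm_mul_le (hui i) (hT.memLp_comp y (hvi i))).trans ?_)
    rw [hT.eLpNorm_comp y (hvi i).1]
  have hconv : ∀ (σ : E n → ℝ), IsTest σ → ∀ i x,
      ∫ ω, u ω i * orbitAvg T σ (fun ω => v ω i) (T x ω) ∂μ =
        (σ ⋆[ContinuousLinearMap.lsmul ℝ ℝ, volume] G i) x := by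
    intro σ hσ i x
    simp only [hT.orbitAvg_comp]
    rw [hT.integral_mul_orbitAvg (hui i) (hvi i) (hσ.comp_add_right x).continuous
      (hσ.comp_add_right x).2, convolution_def, ← integral_sub_right_eq_self _ x]
    simp [hG]
  set g : E n → ℝ := fun x => ∑ i, (ρ ⋆[ContinuousLinearMap.lsmul ℝ ℝ, volume] G i) x with hg
  have hd : ∀ i, Differentiable ℝ (ρ ⋆[ContinuousLinearMap.lsmul ℝ ℝ, volume] G i) := fun i =>
    (contDiff_convolution_test hρ (hGloc i)).differentiable (by simp)
  have key : g h = g 0 := by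
    refine eq_of_partialDeriv_eq_zero (Differentiable.fun_sum fun i _ => hd i) (fun j x => ?_) h 0
    have h1 : partialDeriv j g x =
        ∑ i, (partialDeriv j ρ ⋆[ContinuousLinearMap.lsmul ℝ ℝ, volume] G i) x := by
      simp only [← partialDeriv_convolution hρ (hGloc _), partialDeriv]
      rw [hg, fderiv_fun_sum fun i _ => hd i x]
      simp
    -- The gradient at `x` is the orthogonality relation for the shifted kernel `ρ (· + x)`.
    rw [h1, ← hT.sum_integral_mul_orbitAvg_eq_zero hpq hu hv (hρ.comp_add_right x) j]
    refine Finset.sum_congr rfl fun i _ => ?_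
    rw [← hconv _ (hρ.partialDeriv j)]
    simp only [hT.orbitAvg_comp]
    have h2 : partialDeriv j (fun y => ρ (y + x)) = fun t => partialDeriv j ρ (t + x) :=
      funext fun t => partialDeriv_comp_add_right ρ x j t
    rw [h2]
  simp only [hg, ← hconv ρ hρ, hT.zero] at key
  exact key

end DivCurl

/-! ### Consequences of ergodicity, and bounds for orbit averages -/

section Ergodic

open scoped Convolution

variable {n : ℕ} {Ω : Type*} [MeasurableSpace Ω] {μ : Measure Ω} {T : E n → Ω → Ω}

theorem integral_norm_le_of_eLpNorm_le [IsProbabilityMeasure μ] {F : Type*}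
    [NormedAddCommGroup F] {r M : ℝ≥0∞} (hr : 1 ≤ r) (hM : M ≠ ∞) {w : Ω → F}
    (hw : AEStronglyMeasurable w μ) (h : eLpNorm w r μ ≤ M) : ∫ ω, ‖w ω‖ ∂μ ≤ M.toReal := by
  rw [integral_norm_eq_lintegral_enorm hw, ← eLpNorm_one_eq_lintegral_enorm]
  exact ENNReal.toReal_mono hM ((eLpNorm_le_eLpNorm_of_exponent_le hr hw).trans h)

theorem eLpNorm_midpoint_le {F : Type*} [NormedAddCommGroup F] [NormedSpace ℝ F] {r M : ℝ≥0∞}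
    (hr : 1 ≤ r) {a b : Ω → F} (ha : AEStronglyMeasurable a μ) (hb : AEStronglyMeasurable b μ)
    (haM : eLpNorm a r μ ≤ M) (hbM : eLpNorm b r μ ≤ M) :
    eLpNorm (fun ω => (1 / 2 : ℝ) • (a ω + b ω)) r μ ≤ M := by
  have h1 : eLpNorm (fun ω => (1 / 2 : ℝ) • (a ω + b ω)) r μ =
      ‖(1 / 2 : ℝ)‖ₑ * eLpNorm (a + b) r μ := eLpNorm_const_smul (1 / 2 : ℝ) (a + b) r μ
  have h2 : ‖(1 / 2 : ℝ)‖ₑ = 2⁻¹ := by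
    rw [Real.enorm_eq_ofReal (by norm_num), one_div, ENNReal.ofReal_inv_of_pos (by norm_num)]
    simp
  calc _ = 2⁻¹ * eLpNorm (a + b) r μ := by rw [h1, h2]
    _ ≤ 2⁻¹ * (M + M) := by gcongr; exact (eLpNorm_add_le ha hb hr).trans (add_le_add haM hbM)
    _ = M := by
      rw [← two_mul, ← mul_assoc, ENNReal.inv_mul_cancel (by simp) (by simp), one_mul]

/-- Invariant vector functions of an ergodic system are almost everywhere constant. -/
theorem IsErgodic.exists_ae_eq_const (hT : IsDynamicalSystem μ T) (herg : IsErgodic μ T)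
    {w : Ω → E n} (hw : AEStronglyMeasurable w μ) (h : ∀ x, ∀ᵐ ω ∂μ, w (T x ω) = w ω) :
    ∃ a : E n, ∀ᵐ ω ∂μ, w ω = a := by
  have hm : Measurable (hw.mk w) := hw.stronglyMeasurable_mk.measurable
  have hinv : ∀ x, ∀ᵐ ω ∂μ, hw.mk w (T x ω) = hw.mk w ω := fun x => by
    filter_upwards [h x, hw.ae_eq_mk,
      (hT.measurePreserving x).quasiMeasurePreserving.ae hw.ae_eq_mk] with ω h1 h2 h3
    rw [← h2, ← h3, h1]
  have hc : ∀ i, ∃ c : ℝ, ∀ᵐ ω ∂μ, hw.mk w ω i = c := fun i =>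
    herg _ ((EuclideanSpace.proj (𝕜 := ℝ) i).measurable.comp hm) fun x => by
      filter_upwards [hinv x] with ω hω
      simp [hω]
  choose c hc using hc
  refine ⟨WithLp.toLp 2 c, ?_⟩
  filter_upwards [hw.ae_eq_mk, ae_all_iff.2 hc] with ω h1 h2
  rw [h1]
  ext i
  exact h2 i

/-- If the correlation of `u` with all translates of `w` is constant, it is the product of the
means. -/
theorem IsErgodic.eq_inner_integral [IsProbabilityMeasure μ] (hT : IsDynamicalSystem μ T)
    (herg : IsErgodic μ T) {P Q : ℝ≥0∞} [P.HolderConjugate Q] (hP : P ≠ ∞) (hQ : 1 < Q)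
    {u w : Ω → E n} (hu : MemLp u P μ) (hw : MemLp w Q μ) {c : ℝ}
    (hc : ∀ h, ∫ ω, inner ℝ (u ω) (w (T h ω)) ∂μ = c) :
    c = inner ℝ (∫ ω, u ω ∂μ) (∫ ω, w ω ∂μ) := by
  have hP1 : 1 ≤ P := ENNReal.HolderConjugate.one_le P Q
  set M := eLpNorm w Q μ with hMdef
  have hM : M ≠ ∞ := hw.2.ne
  -- A convex set stable under `T`, carrying what must pass to the limit: the norm bound, the
  -- constant correlation and the mean.
  set C : Set (Ω → E n) := {z | MemLp z Q μ ∧ eLpNorm z Q μ ≤ M ∧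
    (∀ h, ∫ ω, inner ℝ (u ω) (z (T h ω)) ∂μ = c) ∧ ∫ ω, z ω ∂μ = ∫ ω, w ω ∂μ} with hC
  have hCT : ∀ z ∈ C, ∀ x, (fun ω => z (T x ω)) ∈ C := by
    rintro z ⟨h1, h2, h3, h4⟩ x
    refine ⟨hT.memLp_comp x h1, (hT.eLpNorm_comp x h1.1).trans_le h2, fun h => ?_,
      (hT.integral_comp x h1.1).trans h4⟩
    simpa only [hT.add] using h3 (x + h)
  have hCconv : ∀ a ∈ C, ∀ b ∈ C, (fun ω => (1 / 2 : ℝ) • (a ω + b ω)) ∈ C := by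
    rintro a ⟨a1, a2, a3, a4⟩ b ⟨b1, b2, b3, b4⟩
    refine ⟨(a1.add b1).const_smul (1 / 2 : ℝ), eLpNorm_midpoint_le hQ.le a1.1 b1.1 a2 b2,
      fun h => ?_, ?_⟩
    · simp only [inner_smul_right, inner_add_right]
      rw [integral_const_mul, integral_add (integrable_inner_of_memLp hu (hT.memLp_comp h a1))
        (integrable_inner_of_memLp hu (hT.memLp_comp h b1)), a3, b3]
      ring
    · rw [integral_smul, integral_add (a1.integrable hQ.le) (b1.integrable hQ.le), a4, b4,
        ← two_smul ℝ, smul_smul]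
      simp
  have hwC : w ∈ C := ⟨hw, le_rfl, hc, rfl⟩
  obtain ⟨z, φ, w', hφ, hzC, hmin, hlim⟩ := exists_nearMinimizer_tendsto (C := fun _ => C)
    (μ := μ) antitone_const (fun _ => ⟨w, hwC⟩) (fun _ => hCconv)
    (fun w hw => hw.1.integrable hQ.le)
    (fun w hw => integral_norm_le_of_eLpNorm_le hQ.le hM hw.1.1 hw.2.1)
  have hzm : ∀ k, AEStronglyMeasurable (z (φ k)) μ := fun k => (hzC _).1.1
  have hzb : ∀ k, eLpNorm (z (φ k)) Q μ ≤ M := fun k => (hzC _).2.1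
  have hw'm : AEStronglyMeasurable w' μ := aestronglyMeasurable_of_tendsto_ae atTop hzm hlim
  have hinv : ∀ x, ∀ᵐ ω ∂μ, w' (T x ω) = w' ω := by
    intro x
    set B := ∫ ω, bracket (w ω) ∂μ + 1 with hB
    -- A near-minimizer and its translate have equal energy, and their midpoint is again a
    -- competitor; the defect is at most `2/(k+1)`. So the limit does not distinguish `ω` from `T x
    -- ω`.
    have hgap : ∀ k : ℕ, ∫⁻ ω, ‖z k ω - z k (T x ω)‖ₑ ^ (1 / 2 : ℝ) ∂μ ≤
        ENNReal.ofReal (2 * (1 / ((k : ℝ) + 1))) ^ (1 / 4 : ℝ) *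
          ENNReal.ofReal (B + B) ^ (3 / 4 : ℝ) := by
      intro k
      have hzx := hCT _ (hzC k) x
      refine (lintegral_sqrt_enorm_sub_le ((hzC k).1.integrable hQ.le)
        (hzx.1.integrable hQ.le)).trans ?_
      have h1 : ∫ ω, bracket (z k (T x ω)) ∂μ = ∫ ω, bracket (z k ω) ∂μ :=
        hT.integral_comp (g := fun ω => bracket (z k ω)) x
          (continuous_bracket.comp_aestronglyMeasurable (hzC k).1.1)
      have h2 := hmin k _ (hCconv _ (hzC k) _ hzx)
      have h3 := hmin k _ hwC
      have h4 : 1 / ((k : ℝ) + 1) ≤ 1 := by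
        rw [div_le_one (by positivity)]; linarith [k.cast_nonneg (α := ℝ)]
      rw [h1]
      gcongr <;> linarith
    have h0 : Tendsto (fun k : ℕ => ENNReal.ofReal (2 * (1 / ((k : ℝ) + 1))) ^ (1 / 4 : ℝ) *
          ENNReal.ofReal (B + B) ^ (3 / 4 : ℝ)) atTop (𝓝 0) := by
      have h1 : Tendsto (fun k : ℕ => 2 * (1 / ((k : ℝ) + 1))) atTop (𝓝 0) := by
        simpa using tendsto_one_div_add_atTop_nhds_zero_nat.const_mul (2 : ℝ)
      have h2 : Tendsto (fun k : ℕ => ENNReal.ofReal (2 * (1 / ((k : ℝ) + 1))) ^ (1 / 4 : ℝ))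
          atTop (𝓝 0) := by
        have := (ENNReal.continuous_rpow_const (y := 1 / 4)).tendsto 0 |>.comp
          ((ENNReal.tendsto_ofReal h1).trans (by simp))
        simpa [Function.comp_def] using this
      simpa using ENNReal.Tendsto.mul_const h2
        (Or.inr (ENNReal.rpow_ne_top_of_nonneg (by norm_num) ENNReal.ofReal_ne_top))
    have hlimx := (hT.measurePreserving x).quasiMeasurePreserving.ae hlim
    have hint : ∫⁻ ω, ‖w' ω - w' (T x ω)‖ₑ ^ (1 / 2 : ℝ) ∂μ = 0 := by
      refine le_antisymm ?_ bot_le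
      calc ∫⁻ ω, ‖w' ω - w' (T x ω)‖ₑ ^ (1 / 2 : ℝ) ∂μ
          ≤ ∫⁻ ω, liminf (fun k => ‖z (φ k) ω - z (φ k) (T x ω)‖ₑ ^ (1 / 2 : ℝ)) atTop ∂μ := by
            refine lintegral_mono_ae ?_
            filter_upwards [hlim, hlimx] with ω h1 h2
            refine (Tendsto.liminf_eq ?_).ge
            exact ((ENNReal.continuous_rpow_const (y := 1 / 2)).tendsto _).comp (h1.sub h2).enorm
        _ ≤ liminf (fun k => ∫⁻ ω, ‖z (φ k) ω - z (φ k) (T x ω)‖ₑ ^ (1 / 2 : ℝ) ∂μ) atTop :=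
            lintegral_liminf_le' fun k =>
              ((hzm k).sub (hCT _ (hzC (φ k)) x).1.1).enorm.pow_const _
        _ ≤ liminf (fun k => ENNReal.ofReal (2 * (1 / ((φ k : ℝ) + 1))) ^ (1 / 4 : ℝ) *
              ENNReal.ofReal (B + B) ^ (3 / 4 : ℝ)) atTop :=
            liminf_le_liminf (Eventually.of_forall fun k => hgap (φ k))
        _ = 0 := (h0.comp hφ.tendsto_atTop).liminf_eq
    have hmeas : AEMeasurable (fun ω => ‖w' ω - w' (T x ω)‖ₑ ^ (1 / 2 : ℝ)) μ :=
      (hw'm.sub (hw'm.comp_measurePreserving (hT.measurePreserving x))).enorm.pow_const _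
    rw [lintegral_eq_zero_iff' hmeas] at hint
    filter_upwards [hint] with ω hω
    have h1 : ‖w' ω - w' (T x ω)‖ₑ ^ (1 / 2 : ℝ) = 0 := hω
    rw [ENNReal.rpow_eq_zero_iff] at h1
    have h2 : ‖w' ω - w' (T x ω)‖ₑ = 0 := by
      rcases h1 with h1 | h1
      · exact h1.1
      · norm_num at h1
    exact (sub_eq_zero.1 (enorm_eq_zero.1 h2)).symm
  obtain ⟨a, ha⟩ := herg.exists_ae_eq_const hT hw'm hinv
  have e1 : ∫ ω, w ω ∂μ = a := by
    have h1 := tendsto_integral_of_bounded hQ hM hzm hzb hlim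
    simp only [(hzC _).2.2.2] at h1
    rw [tendsto_nhds_unique tendsto_const_nhds h1, integral_congr_ae ha]
    simp
  have h2 := tendsto_integral_inner hP hM hu hzm hzb hlim
  have h3 : ∀ k, ∫ ω, inner ℝ (u ω) (z k ω) ∂μ = c := fun k => by
    simpa only [hT.zero] using (hzC k).2.2.1 0
  simp only [h3] at h2
  rw [tendsto_nhds_unique tendsto_const_nhds h2, e1]
  have h4 : ∫ ω, inner ℝ (u ω) (w' ω) ∂μ = ∫ ω, inner ℝ a (u ω) ∂μ := by
    refine integral_congr_ae ?_
    filter_upwards [ha] with ω hω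
    rw [hω, real_inner_comm]
  rw [h4, integral_inner (hu.integrable hP1), real_inner_comm]

theorem nullMeasurableSet_tendsto {F : Type*} [NormedAddCommGroup F] {w : ℕ → Ω → F} {w' : Ω → F}
    (hw : ∀ k, AEStronglyMeasurable (w k) μ) (hw' : AEStronglyMeasurable w' μ) :
    NullMeasurableSet {ω | Tendsto (fun k => w k ω) atTop (𝓝 (w' ω))} μ := by
  have hm : ∀ k, StronglyMeasurable (fun ω => ‖(hw k).mk (w k) ω - hw'.mk w' ω‖) := fun k =>
    ((hw k).stronglyMeasurable_mk.sub hw'.stronglyMeasurable_mk).norm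
  have h1 : MeasurableSet {ω | Tendsto (fun k => ‖(hw k).mk (w k) ω - hw'.mk w' ω‖) atTop (𝓝 0)} :=
    measurableSet_tendsto _ fun k => (hm k).measurable
  refine h1.nullMeasurableSet.congr ?_
  filter_upwards [ae_all_iff.2 fun k => (hw k).ae_eq_mk, hw'.ae_eq_mk] with ω h2 h3
  refine propext ?_
  change Tendsto (fun k => ‖(hw k).mk (w k) ω - hw'.mk w' ω‖) atTop (𝓝 0) ↔
    Tendsto (fun k => w k ω) atTop (𝓝 (w' ω))
  simp only [← h2, ← h3]
  exact tendsto_iff_norm_sub_tendsto_zero.symm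

variable [SFinite μ]

/-- A property holding at almost every point of almost every orbit holds almost surely. -/
theorem IsDynamicalSystem.ae_of_ae_ae (hT : IsDynamicalSystem μ T) {S : Set Ω}
    (hS : NullMeasurableSet S μ) (h : ∀ᵐ ω ∂μ, ∀ᵐ x : E n, T x ω ∈ S) : ∀ᵐ ω ∂μ, ω ∈ S := by
  have hm : AEMeasurable (Sᶜ.indicator fun _ => (1 : ℝ≥0∞)) μ :=
    aemeasurable_const.indicator₀ hS.compl
  have h1 := hT.lintegral_lintegral volume hm
  have h2 : ∫⁻ ω, ∫⁻ x : E n, Sᶜ.indicator (fun _ => (1 : ℝ≥0∞)) (T x ω) ∂volume ∂μ = 0 := by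
    rw [← lintegral_zero (μ := μ)]
    refine lintegral_congr_ae ?_
    filter_upwards [h] with ω hω
    rw [← lintegral_zero (μ := (volume : Measure (E n)))]
    refine lintegral_congr_ae ?_
    filter_upwards [hω] with x hx
    simp [hx]
  rw [h2, lintegral_indicator_const₀ hS.compl, one_mul] at h1
  rcases mul_eq_zero.1 h1.symm with h3 | h3
  · exact absurd h3 (isOpen_univ.measure_ne_zero volume Set.univ_nonempty)
  · exact h3

/-- Jensen's inequality for the probability measure `ρ dt`, followed by Fubini and invariance.
Evenness of `ρ` replaces `T (-t)` by `T t`. -/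
theorem IsDynamicalSystem.eLpNorm_orbitAvg_le (hT : IsDynamicalSystem μ T) {ρ : E n → ℝ}
    (hρ : Continuous ρ) (hρi : Integrable ρ) (h0 : ∀ x, 0 ≤ ρ x) (h1 : ∫ x, ρ x = 1)
    (hneg : ∀ x, ρ (-x) = ρ x)
    {F : Type*} [NormedAddCommGroup F] [NormedSpace ℝ F] {r : ℝ} (hr : 1 ≤ r) {s : Ω → F}
    (hs : AEStronglyMeasurable s μ) :
    eLpNorm (orbitAvg T ρ s) (ENNReal.ofReal r) μ ≤ eLpNorm s (ENNReal.ofReal r) μ := by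
  have hr0 : 0 < r := by linarith
  have hr1 : ENNReal.ofReal r ≠ 0 := by simpa using hr0
  set ν : Measure (E n) := volume.withDensity fun t => ENNReal.ofReal (ρ t) with hν
  have hνu : ν Set.univ = 1 := by
    rw [hν, withDensity_apply _ MeasurableSet.univ, Measure.restrict_univ,
      ← ofReal_integral_eq_lintegral_ofReal hρi (Eventually.of_forall h0), h1]
    simp
  have : IsProbabilityMeasure ν := ⟨hνu⟩
  have hρm : Measurable fun t => ENNReal.ofReal (ρ t) := hρ.measurable.ennreal_ofReal
  have hle : ∀ᵐ ω ∂μ, ‖orbitAvg T ρ s ω‖ₑ ^ r ≤ ∫⁻ t, ‖s (T t ω)‖ₑ ^ r ∂ν := by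
    filter_upwards [hT.ae_aestronglyMeasurable ν hs] with ω hω
    have h2 : ‖orbitAvg T ρ s ω‖ₑ ≤ eLpNorm (fun t => s (T t ω)) 1 ν := by
      have h3 : orbitAvg T ρ s ω = ∫ t, ρ t • s (T t ω) := by
        rw [orbitAvg, ← integral_neg_eq_self]
        simp [hneg]
      rw [h3, eLpNorm_one_eq_lintegral_enorm, hν,
        lintegral_withDensity_eq_lintegral_mul_non_measurable _ hρm
          (Eventually.of_forall fun _ => ENNReal.ofReal_lt_top)]
      refine (enorm_integral_le_lintegral_enorm _).trans (le_of_eq ?_)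
      congr 1; ext t
      rw [enorm_smul, Real.enorm_eq_ofReal (h0 t)]
      rfl
    have h4 := h2.trans (eLpNorm_le_eLpNorm_of_exponent_le
      (show (1 : ℝ≥0∞) ≤ ENNReal.ofReal r by simpa using hr) hω)
    rw [eLpNorm_eq_lintegral_rpow_enorm_toReal hr1 ENNReal.ofReal_ne_top,
      ENNReal.toReal_ofReal hr0.le] at h4
    have h5 := ENNReal.rpow_le_rpow h4 hr0.le
    rwa [← ENNReal.rpow_mul, one_div, inv_mul_cancel₀ hr0.ne', ENNReal.rpow_one] at h5
  rw [eLpNorm_eq_lintegral_rpow_enorm_toReal hr1 ENNReal.ofReal_ne_top,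
    eLpNorm_eq_lintegral_rpow_enorm_toReal hr1 ENNReal.ofReal_ne_top, ENNReal.toReal_ofReal hr0.le]
  refine ENNReal.rpow_le_rpow ((lintegral_mono_ae hle).trans ?_) (by positivity)
  rw [hT.lintegral_lintegral ν (g := fun ω => ‖s ω‖ₑ ^ r) (hs.enorm.pow_const r), hνu, one_mul]

/-- Coordinates commute with the Bochner integral once the integrand is integrable, which holds on
almost every orbit by local integrability of the realization. -/
theorem IsDynamicalSystem.ae_orbitAvg_coord (hT : IsDynamicalSystem μ T) {r : ℝ} (hr : 1 ≤ r)
    {ρ : E n → ℝ} (hρ : Continuous ρ) (hρc : HasCompactSupport ρ) {v : Ω → E n}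
    (hv : MemLp v (ENNReal.ofReal r) μ) :
    ∀ᵐ ω ∂μ, ∀ i, orbitAvg T ρ v ω i = orbitAvg T ρ (fun ω => v ω i) ω := by
  filter_upwards [hT.ae_memLpLoc (by linarith) hv] with ω hω i
  have hex := hρc.convolutionExists_left (ContinuousLinearMap.lsmul ℝ ℝ) hρ
    (hω.locallyIntegrable hr) 0
  have hint : Integrable (fun t => ρ t • v (T (-t) ω)) := by
    simpa [ConvolutionExistsAt] using hex
  have := (EuclideanSpace.proj (𝕜 := ℝ) i).integral_comp_comm hint
  simpa [orbitAvg] using this.symm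

end Ergodic

/-! ### The div-curl identity without mollification -/

section DivCurlProduct

open scoped Convolution

variable {n : ℕ} {Ω : Type*} [MeasurableSpace Ω] {μ : Measure Ω} [IsProbabilityMeasure μ]
  {T : E n → Ω → Ω}

/-- The stochastic div-curl identity: `E(u · v) = E(u) · E(v)` for `u` solenoidal and `v`
potential. -/
theorem integral_inner_sol_pot (hT : IsDynamicalSystem μ T) (herg : IsErgodic μ T) {p q : ℝ}
    (hpq : p.HolderConjugate q) {u v : Ω → E n} (hu : u ∈ LpSol μ T p) (hv : v ∈ LpPot μ T q) :
    ∫ ω, inner ℝ (u ω) (v ω) ∂μ = inner ℝ (∫ ω, u ω ∂μ) (∫ ω, v ω ∂μ) := by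
  have hconj := hpq.ennrealOfReal
  have hQ : 1 < ENNReal.ofReal q := by simpa using hpq.symm.lt
  have hq1 : 1 ≤ q := hpq.symm.lt.le
  let b : ℕ → ContDiffBump (0 : E n) := fun k =>
    ⟨1 / ((k : ℝ) + 1), 2 * (1 / ((k : ℝ) + 1)), by positivity, by
      have : 0 < 1 / ((k : ℝ) + 1) := by positivity
      linarith⟩
  set ρ : ℕ → E n → ℝ := fun k => (b k).normed volume with hρdef
  have hρ : ∀ k, IsTest (ρ k) := fun k =>
    ⟨(b k).contDiff_normed, (b k).hasCompactSupport_normed⟩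
  set w : ℕ → Ω → E n := fun k => orbitAvg T (ρ k) v with hw
  have hwm : ∀ k, AEStronglyMeasurable (w k) μ := fun k =>
    hT.aestronglyMeasurable_orbitAvg (hρ k).continuous hv.1.1
  have hwb : ∀ k, eLpNorm (w k) (ENNReal.ofReal q) μ ≤ eLpNorm v (ENNReal.ofReal q) μ :=
    fun k => hT.eLpNorm_orbitAvg_le (hρ k).continuous (b k).integrable_normed
      (b k).nonneg_normed (b k).integral_normed (b k).normed_neg hq1 hv.1.1
  have hwL : ∀ k, MemLp (w k) (ENNReal.ofReal q) μ := fun k =>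
    ⟨hwm k, (hwb k).trans_lt hv.1.2⟩
  -- On almost every orbit the mollified realization converges at almost every point; stationarity
  -- transfers this to almost every `ω`.
  have hlim : ∀ᵐ ω ∂μ, Tendsto (fun k => w k ω) atTop (𝓝 (v ω)) := by
    refine hT.ae_of_ae_ae (nullMeasurableSet_tendsto hwm hv.1.1) ?_
    filter_upwards [hv.2] with ω hω
    have h0 : Tendsto (fun k => (b k).rOut) atTop (𝓝 0) := by
      simpa [b] using tendsto_one_div_add_atTop_nhds_zero_nat.const_mul (2 : ℝ)
    have := ContDiffBump.ae_convolution_tendsto_right_of_locallyIntegrable (K := 2) h0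
      (Eventually.of_forall fun k => le_rfl) (hω.1.locallyIntegrable hq1)
    filter_upwards [this] with x hx
    change Tendsto (fun k => w k (T x ω)) atTop (𝓝 (v (T x ω)))
    simp only [hw, hT.orbitAvg_apply]
    exact hx
  have hexp : ∀ k h, ∫ ω, inner ℝ (u ω) (w k (T h ω)) ∂μ =
      ∑ i, ∫ ω, u ω i * orbitAvg T (ρ k) (fun ω => v ω i) (T h ω) ∂μ := by
    intro k h
    have hcoord := (hT.measurePreserving h).quasiMeasurePreserving.ae
      (hT.ae_orbitAvg_coord hq1 (hρ k).continuous (hρ k).2 hv.1)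
    have h1 : ∀ i, Integrable
        (fun ω => u ω i * orbitAvg T (ρ k) (fun ω => v ω i) (T h ω)) μ := fun i => by
      simp only [hT.orbitAvg_comp]
      exact hT.integrable_mul_orbitAvg (memLp_coord hu.1 i) (memLp_coord hv.1 i)
        ((hρ k).comp_add_right h).continuous ((hρ k).comp_add_right h).2
    rw [← integral_finsetSum _ fun i _ => h1 i]
    refine integral_congr_ae ?_
    filter_upwards [hcoord] with ω hω
    simp only [hw, PiLp.inner_apply, hω]
    exact Finset.sum_congr rfl fun i _ => by simp [mul_comm]
  -- The correlation of `u` with all translates of `w k` is constant, so ergodicity evaluates it.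
  have hk : ∀ k, ∫ ω, inner ℝ (u ω) (w k ω) ∂μ =
      inner ℝ (∫ ω, u ω ∂μ) (∫ ω, w k ω ∂μ) := fun k => by
    refine herg.eq_inner_integral hT ENNReal.ofReal_ne_top hQ hu.1 (hwL k) fun h => ?_
    have h0 := hexp k 0
    simp only [hT.zero] at h0
    rw [hexp, h0, hT.sum_integral_mul_orbitAvg_comp hpq hu hv (hρ k)]
  have l1 := tendsto_integral_inner ENNReal.ofReal_ne_top hv.1.2.ne hu.1 hwm hwb hlim
  have l2 := (tendsto_const_nhds (x := ∫ ω, u ω ∂μ)).inner (𝕜 := ℝ)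
    (tendsto_integral_of_bounded hQ hv.1.2.ne hwm hwb hlim)
  simp only [hk] at l1
  exact tendsto_nhds_unique l1 l2

end DivCurlProduct

/-! ### Fields annihilating a class of test fields -/

section Annihilator

variable {n : ℕ}

/-- Test vector fields which define solenoidal fields. -/
def gradientTests (n : ℕ) : Set (E n → E n) :=
  {ψ | ∃ φ : E n → ℝ, IsTest φ ∧ ψ = fun x => WithLp.toLp 2 fun i => partialDeriv i φ x}

/-- Test vector fields which define potential fields. -/
def curlTests (n : ℕ) : Set (E n → E n) :=
  {ψ | ∃ (i j : Fin n) (φ : E n → ℝ), IsTest φ ∧ ψ = fun x =>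
    partialDeriv j φ x • EuclideanSpace.single i (1 : ℝ)
      - partialDeriv i φ x • EuclideanSpace.single j (1 : ℝ)}

/-- Continuous compactly supported vector fields of zero mean. -/
structure IsTestField (ψ : E n → E n) : Prop where
  continuous : Continuous ψ
  hasCompactSupport : HasCompactSupport ψ
  integral_eq_zero : ∫ x, ψ x = 0

theorem isTestField_of_mem_gradientTests {ψ : E n → E n} (h : ψ ∈ gradientTests n) :
    IsTestField ψ := by
  obtain ⟨φ, hφ, rfl⟩ := h
  have h1 : Continuous fun x : E n => (WithLp.toLp 2 fun i => partialDeriv i φ x : E n) :=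
    (PiLp.continuous_toLp 2 _).comp (continuous_pi fun i => (hφ.partialDeriv i).continuous)
  have h2 : HasCompactSupport
      fun x : E n => (WithLp.toLp 2 fun i => partialDeriv i φ x : E n) := by
    refine (hφ.2.fderiv (𝕜 := ℝ)).mono fun x hx => ?_
    contrapose! hx
    have : fderiv ℝ φ x = 0 := by simpa using hx
    have h0 : ∀ i, partialDeriv i φ x = 0 := fun i => by simp [partialDeriv, this]
    simp only [h0, Function.mem_support, not_not]
    rfl
  refine ⟨h1, h2, ?_⟩
  ext i
  have h3 : ∫ x, partialDeriv i φ x = (∫ x, (WithLp.toLp 2 fun i => partialDeriv i φ x : E n)) i :=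
    (EuclideanSpace.proj (𝕜 := ℝ) i).integral_comp_comm
      (h1.integrable_of_hasCompactSupport (μ := volume) h2)
  rw [← h3, integral_partialDeriv_eq_zero hφ]
  simp

theorem isTestField_of_mem_curlTests {ψ : E n → E n} (h : ψ ∈ curlTests n) :
    IsTestField ψ := by
  obtain ⟨i, j, φ, hφ, rfl⟩ := h
  have hi := hφ.partialDeriv i
  have hj := hφ.partialDeriv j
  refine ⟨(hj.continuous.smul continuous_const).sub (hi.continuous.smul continuous_const),
    hj.2.smul_right.sub hi.2.smul_right, ?_⟩
  rw [integral_sub ((hj.continuous.integrable_of_hasCompactSupport hj.2).smul_const _)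
    ((hi.continuous.integrable_of_hasCompactSupport hi.2).smul_const _), integral_smul_const,
    integral_smul_const, integral_partialDeriv_eq_zero hφ, integral_partialDeriv_eq_zero hφ]
  simp

theorem IsTestField.integrable_inner {ψ V : E n → E n} (hψ : IsTestField ψ)
    (hV : LocallyIntegrable V) : Integrable fun x => inner ℝ (ψ x) (V x) := by
  have h : ∀ i, Integrable fun x => V x i * ψ x i := fun i =>
    integrable_test_mul ((EuclideanSpace.proj (𝕜 := ℝ) i).continuous.comp hψ.continuous)
      (hψ.hasCompactSupport.comp_left (g := fun z : E n => z i) rfl)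
      (locallyIntegrable_coord hV i)
  refine (integrable_finsetSum Finset.univ fun i _ => h i).congr
    (Eventually.of_forall fun x => ?_)
  simp [PiLp.inner_apply]

/-- `V ∈ L^r_loc` annihilates the test fields in `𝒯`. -/
def Annihilates (𝒯 : Set (E n → E n)) (r : ℝ) (V : E n → E n) : Prop :=
  MemLpLoc r V ∧ ∀ ψ ∈ 𝒯, ∫ x, inner ℝ (ψ x) (V x) = 0

/-- With this form and its potential analogue, one argument proves convexity and closedness of both
classes. -/
theorem isSolenoidal_iff {r : ℝ} (hr : 1 ≤ r) {V : E n → E n} :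
    IsSolenoidal r V ↔ Annihilates (gradientTests n) r V := by
  refine and_congr_right fun hV => ?_
  have hloc := hV.locallyIntegrable hr
  have key : ∀ φ : E n → ℝ, IsTest φ → ∑ i, ∫ x, V x i * partialDeriv i φ x =
      ∫ x, inner ℝ (WithLp.toLp 2 fun i => partialDeriv i φ x : E n) (V x) := fun φ hφ => by
    rw [← integral_finsetSum _ fun i _ => integrable_test_mul (hφ.partialDeriv i).continuous
      (hφ.partialDeriv i).2 (locallyIntegrable_coord hloc i)]
    simp [PiLp.inner_apply]
  constructor
  · rintro h _ ⟨φ, hφ, rfl⟩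
    rw [← key φ hφ, h φ hφ]
  · intro h φ hφ
    rw [key φ hφ, h _ ⟨φ, hφ, rfl⟩]

theorem isPotential_iff {r : ℝ} {V : E n → E n} :
    IsPotential r V ↔ Annihilates (curlTests n) r V := by
  refine and_congr_right fun hV => ?_
  have key : ∀ (i j : Fin n) (φ : E n → ℝ) x,
      inner ℝ (partialDeriv j φ x • EuclideanSpace.single i (1 : ℝ)
        - partialDeriv i φ x • EuclideanSpace.single j (1 : ℝ)) (V x) =
      V x i * partialDeriv j φ x - V x j * partialDeriv i φ x := fun i j φ x => by
    simp only [inner_sub_left, real_inner_smul_left, EuclideanSpace.inner_single_left]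
    simp [mul_comm]
  constructor
  · rintro h _ ⟨i, j, φ, hφ, rfl⟩
    simpa only [key] using h i j φ hφ
  · intro h i j φ hφ
    simpa only [key] using h _ ⟨i, j, φ, hφ, rfl⟩

theorem Annihilates.midpoint {𝒯 : Set (E n → E n)} (h𝒯 : ∀ ψ ∈ 𝒯, IsTestField ψ) {r : ℝ}
    (hr : 1 ≤ r) {V W : E n → E n} (hV : Annihilates 𝒯 r V) (hW : Annihilates 𝒯 r W) :
    Annihilates 𝒯 r fun x => (1 / 2 : ℝ) • (V x + W x) := by
  refine ⟨fun K hK => ((hV.1 K hK).add (hW.1 K hK)).const_smul (1 / 2 : ℝ), fun ψ hψ => ?_⟩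
  simp only [inner_smul_right, inner_add_right]
  rw [integral_const_mul, integral_add
    ((h𝒯 ψ hψ).integrable_inner (hV.1.locallyIntegrable hr))
    ((h𝒯 ψ hψ).integrable_inner (hW.1.locallyIntegrable hr)), hV.2 ψ hψ, hW.2 ψ hψ]
  simp

/-- Constants are annihilated because test fields have zero mean. -/
theorem Annihilates.const_add {𝒯 : Set (E n → E n)} (h𝒯 : ∀ ψ ∈ 𝒯, IsTestField ψ) {r : ℝ}
    (hr : 1 ≤ r) {V : E n → E n} (hV : Annihilates 𝒯 r V) (a : E n) :
    Annihilates 𝒯 r fun x => a + V x := by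
  refine ⟨fun K hK => ?_, fun ψ hψ => ?_⟩
  · have : IsFiniteMeasure (volume.restrict K) := ⟨by
      rw [Measure.restrict_apply_univ]; exact hK.measure_lt_top⟩
    exact (memLp_const a).add (hV.1 K hK)
  · have hψ' := h𝒯 ψ hψ
    have hi := hψ'.continuous.integrable_of_hasCompactSupport (μ := volume) hψ'.hasCompactSupport
    simp only [inner_add_right]
    rw [integral_add (hi.inner_const a) (hψ'.integrable_inner (hV.1.locallyIntegrable hr)),
      hV.2 ψ hψ, add_zero]
    have : ∀ x, inner ℝ (ψ x) a = inner ℝ a (ψ x) := fun x => real_inner_comm _ _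
    simp only [this]
    rw [integral_inner hi, hψ'.integral_eq_zero, inner_zero_right]

variable {Ω : Type*} [MeasurableSpace Ω] {μ : Measure Ω} {T : E n → Ω → Ω}

/-- `L^r` functions almost all of whose realizations annihilate the test fields in `𝒯`. -/
def LpAnn (μ : Measure Ω) (T : E n → Ω → Ω) (𝒯 : Set (E n → E n)) (r : ℝ) : Set (Ω → E n) :=
  {f | MemLp f (ENNReal.ofReal r) μ ∧ ∀ᵐ ω ∂μ, Annihilates 𝒯 r fun x => f (T x ω)}

theorem LpSol_eq_LpAnn {r : ℝ} (hr : 1 ≤ r) : LpSol μ T r = LpAnn μ T (gradientTests n) r := by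
  ext f
  simp only [LpSol, LpAnn, isSolenoidal_iff hr]

theorem LpPot_eq_LpAnn (r : ℝ) : LpPot μ T r = LpAnn μ T (curlTests n) r := by
  ext f
  simp only [LpPot, LpAnn, isPotential_iff]

theorem LpAnn.midpoint {𝒯 : Set (E n → E n)} (h𝒯 : ∀ ψ ∈ 𝒯, IsTestField ψ) {r : ℝ}
    (hr : 1 ≤ r) {a b : Ω → E n} (ha : a ∈ LpAnn μ T 𝒯 r) (hb : b ∈ LpAnn μ T 𝒯 r) :
    (fun ω => (1 / 2 : ℝ) • (a ω + b ω)) ∈ LpAnn μ T 𝒯 r := by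
  refine ⟨(ha.1.add hb.1).const_smul (1 / 2 : ℝ), ?_⟩
  filter_upwards [ha.2, hb.2] with ω h1 h2
  exact h1.midpoint h𝒯 hr h2

theorem LpAnn.const_add [IsFiniteMeasure μ] {𝒯 : Set (E n → E n)}
    (h𝒯 : ∀ ψ ∈ 𝒯, IsTestField ψ) {r : ℝ} (hr : 1 ≤ r) {a : Ω → E n} (ha : a ∈ LpAnn μ T 𝒯 r)
    (z : E n) : (fun ω => z + a ω) ∈ LpAnn μ T 𝒯 r := by
  refine ⟨(memLp_const z).add ha.1, ?_⟩
  filter_upwards [ha.2] with ω h1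
  exact h1.const_add h𝒯 hr z

theorem IsTestField.enorm_integral_inner_le {ψ V : E n → E n} {R : ℕ}
    (hR : tsupport ψ ⊆ Metric.closedBall 0 (R : ℝ)) {C : ℝ}
    (hC : ∀ x, ‖ψ x‖ ≤ C) : ‖∫ x, inner ℝ (ψ x) (V x)‖ₑ ≤
      ENNReal.ofReal C * ∫⁻ x in Metric.closedBall 0 (R : ℝ), ‖V x‖ₑ := by
  have h1 : ∫ x, inner ℝ (ψ x) (V x) =
      ∫ x in Metric.closedBall 0 (R : ℝ), inner ℝ (ψ x) (V x) := by
    refine (setIntegral_eq_integral_of_forall_compl_eq_zero fun x hx => ?_).symm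
    rw [image_eq_zero_of_notMem_tsupport fun h => hx (hR h), inner_zero_left]
  rw [h1, ← lintegral_const_mul' _ _ ENNReal.ofReal_ne_top]
  refine (enorm_integral_le_lintegral_enorm _).trans (lintegral_mono fun x => ?_)
  have h2 : ‖inner ℝ (ψ x) (V x)‖ ≤ C * ‖V x‖ :=
    (norm_inner_le_norm _ _).trans (mul_le_mul_of_nonneg_right (hC x) (norm_nonneg _))
  have hC0 : 0 ≤ C := (norm_nonneg _).trans (hC x)
  rw [← ofReal_norm, ← ofReal_norm, ← ENNReal.ofReal_mul hC0]
  exact ENNReal.ofReal_le_ofReal h2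

/-- `LpAnn` is closed under almost everywhere convergence of bounded sequences. -/
theorem LpAnn.of_tendsto_ae [IsFiniteMeasure μ] (hT : IsDynamicalSystem μ T)
    {𝒯 : Set (E n → E n)} (h𝒯 : ∀ ψ ∈ 𝒯, IsTestField ψ) {r : ℝ} (hr : 1 < r) {M : ℝ≥0∞}
    (hM : M ≠ ∞) {w : ℕ → Ω → E n} {w' : Ω → E n} (hw : ∀ k, w k ∈ LpAnn μ T 𝒯 r)
    (hb : ∀ k, eLpNorm (w k) (ENNReal.ofReal r) μ ≤ M)
    (hlim : ∀ᵐ ω ∂μ, Tendsto (fun k => w k ω) atTop (𝓝 (w' ω))) : w' ∈ LpAnn μ T 𝒯 r := by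
  have hr1 : 1 < ENNReal.ofReal r := by simpa using hr
  have hwm : ∀ k, AEStronglyMeasurable (w k) μ := fun k => (hw k).1.1
  have hw' := memLp_of_tendsto_ae hM hwm hb hlim
  refine ⟨hw', ?_⟩
  have hL1 := tendsto_eLpNorm_one_sub hr1 hM hwm hb hlim
  have hev : ∀ m : ℕ, ∀ᶠ k in atTop, eLpNorm (w k - w') 1 μ ≤ (2⁻¹ : ℝ≥0∞) ^ m := fun m =>
    hL1.eventually (Iic_mem_nhds (ENNReal.pow_pos (by simp) m))
  obtain ⟨φ, -, hφ⟩ := extraction_forall_of_eventually hev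
  -- The exceptional null set must not depend on the test field, and there are uncountably many of
  -- those. Convergence in `L¹` on countably many balls handles them all at once; Fubini and the
  -- summable `2⁻¹ ^ k` bounds provide it.
  have hball : ∀ R : ℕ, ∀ᵐ ω ∂μ, Tendsto (fun k => ∫⁻ x in Metric.closedBall (0 : E n) (R : ℝ),
      ‖w' (T x ω) - w (φ k) (T x ω)‖ₑ) atTop (𝓝 0) := by
    intro R
    set ν : Measure (E n) := volume.restrict (Metric.closedBall 0 (R : ℝ)) with hν
    have hfin : ν Set.univ ≠ ∞ := by
      rw [hν, Measure.restrict_apply_univ]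
      exact (isCompact_closedBall _ _).measure_ne_top
    have hsub : ∀ k, AEStronglyMeasurable (fun ω => w' ω - w (φ k) ω) μ := fun k =>
      hw'.1.sub (hwm (φ k))
    have hm : ∀ k, AEMeasurable (fun ω => ∫⁻ x, ‖w' (T x ω) - w (φ k) (T x ω)‖ₑ ∂ν) μ := fun k =>
      (hT.aestronglyMeasurable_uncurry_swap ν (hsub k)).enorm.lintegral_prod_right'
    have hsum : ∫⁻ ω, ∑' k, ∫⁻ x, ‖w' (T x ω) - w (φ k) (T x ω)‖ₑ ∂ν ∂μ ≠ ∞ := by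
      rw [lintegral_tsum hm]
      have h1 : ∀ k, ∫⁻ ω, ∫⁻ x, ‖w' (T x ω) - w (φ k) (T x ω)‖ₑ ∂ν ∂μ ≤
          ν Set.univ * (2⁻¹ : ℝ≥0∞) ^ k := fun k => by
        rw [hT.lintegral_lintegral ν (g := fun ω => ‖w' ω - w (φ k) ω‖ₑ) (hsub k).enorm]
        gcongr
        refine le_trans (le_of_eq ?_) (hφ k)
        rw [eLpNorm_one_eq_lintegral_enorm]
        simp only [Pi.sub_apply, enorm_sub_rev]
      refine ne_top_of_le_ne_top ?_ (ENNReal.tsum_le_tsum h1)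
      rw [ENNReal.tsum_mul_left, ENNReal.tsum_geometric]
      exact ENNReal.mul_ne_top hfin (by simp)
    filter_upwards [ae_lt_top' (AEMeasurable.tsum hm) hsum] with ω hω
    exact ENNReal.tendsto_atTop_zero_of_tsum_ne_top hω.ne
  filter_upwards [ae_all_iff.2 hball, ae_all_iff.2 fun k => (hw (φ k)).2,
    hT.ae_memLpLoc (by linarith) hw'] with ω h1 h2 h3
  refine ⟨h3, fun ψ hψ => ?_⟩
  have hψ' := h𝒯 ψ hψ
  obtain ⟨C, hC⟩ := hψ'.continuous.bounded_above_of_compact_support hψ'.hasCompactSupport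
  obtain ⟨R₀, hR₀⟩ := hψ'.hasCompactSupport.isBounded.subset_closedBall 0
  obtain ⟨R, hR⟩ := exists_nat_ge R₀
  have hsupp := hR₀.trans (Metric.closedBall_subset_closedBall (x := (0 : E n)) hR)
  have hle : ∀ k, ‖∫ x, inner ℝ (ψ x) (w' (T x ω))‖ₑ ≤ ENNReal.ofReal C *
      ∫⁻ x in Metric.closedBall (0 : E n) (R : ℝ), ‖w' (T x ω) - w (φ k) (T x ω)‖ₑ := fun k => by
    have h4 := IsTestField.enorm_integral_inner_le
      (V := fun x => w' (T x ω) - w (φ k) (T x ω)) hsupp hC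
    simp only [inner_sub_right] at h4
    rwa [integral_sub (hψ'.integrable_inner (h3.locallyIntegrable hr.le))
      (hψ'.integrable_inner ((h2 k).1.locallyIntegrable hr.le)), (h2 k).2 ψ hψ, sub_zero] at h4
  have hlim0 := ENNReal.Tendsto.const_mul (h1 R) (Or.inr (ENNReal.ofReal_ne_top (r := C)))
  rw [mul_zero] at hlim0
  exact enorm_eq_zero.1 (le_antisymm (ge_of_tendsto' hlim0 hle) bot_le)

end Annihilator

/-! ### Integrals of extended real functions -/

section ExtIntegral

/-- The excess of `x` over a real lower bound `a`. -/
noncomputable def excess (x : EReal) (a : ℝ) : ℝ≥0∞ := (x - (a : EReal)).toENNReal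

theorem excess_coe (b a : ℝ) : excess (b : EReal) a = ENNReal.ofReal (b - a) := by
  rw [excess, ← EReal.coe_sub, EReal.real_coe_toENNReal]

theorem excess_top (a : ℝ) : excess ⊤ a = ∞ := by
  rw [excess, EReal.top_sub_coe, EReal.toENNReal_top]

theorem excess_mono {x y : EReal} (h : x ≤ y) (a : ℝ) : excess x a ≤ excess y a :=
  EReal.toENNReal_le_toENNReal (EReal.sub_le_sub h le_rfl)

theorem excess_eq_zero {x : EReal} {a : ℝ} (h : excess x a = 0) : x ≤ a :=
  EReal.sub_nonpos.1 (EReal.toENNReal_eq_zero_iff.1 h)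

theorem continuous_excess (a : ℝ) : Continuous fun x => excess x a := by
  refine EReal.continuous_toENNReal.comp (continuous_iff_continuousAt.2 fun x => ?_)
  simp only [sub_eq_add_neg, ← EReal.coe_neg]
  exact (EReal.continuousAt_add (p := (x, ((-a : ℝ) : EReal))) (Or.inr (EReal.coe_ne_bot _))
    (Or.inr (EReal.coe_ne_top _))).comp
      (f := fun x : EReal => (x, ((-a : ℝ) : EReal)))
      (continuous_id.prodMk continuous_const).continuousAt

theorem ofReal_le_excess {x : EReal} {a b : ℝ} (h : ((b + a : ℝ) : EReal) ≤ x) :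
    ENNReal.ofReal b ≤ excess x a := by
  refine le_trans (le_of_eq ?_) (excess_mono h a)
  rw [excess_coe, add_sub_cancel_right]

/-- The lower bounds on `x` and `y` ensure that no truncation at zero occurs on the right, so
convexity survives the passage to `ℝ≥0∞`. -/
theorem excess_midpoint_le {x y z : EReal} {a : ℝ} (hx : (a : EReal) ≤ x) (hy : (a : EReal) ≤ y)
    (hz : z ≤ ((1 / 2 : ℝ) : EReal) * x + ((1 / 2 : ℝ) : EReal) * y) :
    excess z a ≤ 2⁻¹ * excess x a + 2⁻¹ * excess y a := by
  induction x with
  | bot => simp at hx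
  | top => rw [excess_top, ENNReal.mul_top (by simp)]; simp
  | coe x =>
    induction y with
    | bot => simp at hy
    | top => rw [excess_top, ENNReal.mul_top (by simp)]; simp
    | coe y =>
      rw [← EReal.coe_mul, ← EReal.coe_mul, ← EReal.coe_add] at hz
      have hx' : a ≤ x := by exact_mod_cast hx
      have hy' : a ≤ y := by exact_mod_cast hy
      have h2 : (2⁻¹ : ℝ≥0∞) = ENNReal.ofReal (1 / 2) := by
        rw [one_div, ENNReal.ofReal_inv_of_pos (by norm_num)]; simp
      refine (excess_mono hz a).trans (le_of_eq ?_)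
      rw [excess_coe, excess_coe, excess_coe, h2, ← ENNReal.ofReal_mul (by norm_num),
        ← ENNReal.ofReal_mul (by norm_num),
        ← ENNReal.ofReal_add (by linarith) (by linarith)]
      congr 1; ring

variable {Ω : Type*} [MeasurableSpace Ω] {μ : Measure Ω}

theorem aemeasurable_excess {g : Ω → EReal} {s : Ω → ℝ} (hg : AEMeasurable g μ)
    (hs : AEMeasurable s μ) : AEMeasurable (fun ω => excess (g ω) (s ω)) μ := by
  have : AEMeasurable (fun ω => g ω - (s ω : EReal)) μ :=
    hg.sub (measurable_coe_real_ereal.comp_aemeasurable hs)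
  exact EReal.continuous_toENNReal.measurable.comp_aemeasurable this

/-- The integral of a function bounded below by an integrable function. -/
theorem extIntegral_eq {g : Ω → EReal} (hg : AEMeasurable g μ) {s : Ω → ℝ} (hs : Integrable s μ)
    (h : ∀ᵐ ω ∂μ, (s ω : EReal) ≤ g ω) :
    extIntegral μ g = ((∫⁻ ω, excess (g ω) (s ω) ∂μ : ℝ≥0∞) : EReal) + ((∫ ω, s ω ∂μ : ℝ) : EReal) := by
  -- This is `g = (g - s) + s` with negative parts moved across, so no infinite quantity is
  -- subtracted. After integration only the terms in `g⁺` and `g - s` can be infinite.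
  have hpt : ∀ᵐ ω ∂μ, (g ω).toENNReal + ENNReal.ofReal (-s ω) =
      excess (g ω) (s ω) + (ENNReal.ofReal (s ω) + (-g ω).toENNReal) := by
    filter_upwards [h] with ω hω
    generalize g ω = x at *
    generalize s ω = a at *
    induction x with
    | bot => simp at hω
    | top => simp [excess_top]
    | coe x =>
      have hω' : a ≤ x := by exact_mod_cast hω
      rw [excess_coe, ← EReal.coe_neg, EReal.real_coe_toENNReal, EReal.real_coe_toENNReal,
        ENNReal.ofReal, ENNReal.ofReal, ENNReal.ofReal, ENNReal.ofReal, ENNReal.ofReal]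
      norm_cast
      rw [← NNReal.coe_inj]
      push_cast [Real.coe_toNNReal']
      rw [max_eq_left (sub_nonneg.2 hω')]
      have h1 := max_zero_sub_max_neg_zero_eq_self x
      have h2 := max_zero_sub_max_neg_zero_eq_self a
      linarith
  have hgm : AEMeasurable (fun ω => (g ω).toENNReal) μ :=
    EReal.continuous_toENNReal.measurable.comp_aemeasurable hg
  have hgn : AEMeasurable (fun ω => (-g ω).toENNReal) μ :=
    EReal.continuous_toENNReal.measurable.comp_aemeasurable hg.neg
  have hsm : AEMeasurable s μ := hs.1.aemeasurable
  have hint := lintegral_congr_ae hpt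
  rw [lintegral_add_left' hgm, lintegral_add_left' (aemeasurable_excess hg hsm),
    lintegral_add_left' hsm.ennreal_ofReal] at hint
  have hSn : ∫⁻ ω, ENNReal.ofReal (-s ω) ∂μ ≠ ∞ := hs.neg.lintegral_lt_top.ne
  have hSp : ∫⁻ ω, ENNReal.ofReal (s ω) ∂μ ≠ ∞ := hs.lintegral_lt_top.ne
  have hGn : ∫⁻ ω, (-g ω).toENNReal ∂μ ≠ ∞ := by
    refine ne_top_of_le_ne_top hSn (lintegral_mono_ae ?_)
    filter_upwards [h] with ω hω
    rw [← EReal.real_coe_toENNReal, EReal.coe_neg]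
    exact EReal.toENNReal_le_toENNReal (EReal.neg_le_neg_iff.2 hω)
  rw [extIntegral, integral_eq_lintegral_pos_part_sub_lintegral_neg_part hs]
  generalize ∫⁻ ω, (-g ω).toENNReal ∂μ = G at *
  generalize ∫⁻ ω, (g ω).toENNReal ∂μ = A at *
  generalize ∫⁻ ω, ENNReal.ofReal (-s ω) ∂μ = N at *
  generalize ∫⁻ ω, ENNReal.ofReal (s ω) ∂μ = P at *
  generalize ∫⁻ ω, excess (g ω) (s ω) ∂μ = D at *
  lift G to NNReal using hGn
  lift N to NNReal using hSn
  lift P to NNReal using hSp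
  induction D with
  | top =>
    have : A = ∞ := by
      by_contra hA
      lift A to NNReal using hA
      rw [top_add] at hint
      exact ENNReal.add_ne_top.2 ⟨ENNReal.coe_ne_top, ENNReal.coe_ne_top⟩ hint
    subst this
    rfl
  | coe D =>
    have hA : A ≠ ∞ := by
      rintro rfl
      rw [top_add] at hint
      have : (D : ℝ≥0∞) + (P + G) ≠ ∞ := by finiteness
      exact this hint.symm
    lift A to NNReal using hA
    have hr : (A : ℝ) + N = D + (P + G) := by exact_mod_cast hint
    have e1 : ((A : ℝ≥0∞) : EReal) = ((A : ℝ) : EReal) := rfl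
    have e2 : ((G : ℝ≥0∞) : EReal) = ((G : ℝ) : EReal) := rfl
    have e3 : ((D : ℝ≥0∞) : EReal) = ((D : ℝ) : EReal) := rfl
    rw [e1, e2, e3, ENNReal.coe_toReal, ENNReal.coe_toReal, ← EReal.coe_sub, ← EReal.coe_add]
    congr 1
    linarith

end ExtIntegral

/-! ### Existence of minimizers -/

section Minimizer

variable {n : ℕ} {Ω : Type*} [MeasurableSpace Ω] {μ : Measure Ω} {T : E n → Ω → Ω}

theorem eLpNorm_le_of_lintegral_le {w : Ω → E n} {r c : ℝ} (hr : 0 < r) (hc : 0 < c) {A : ℝ≥0∞}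
    (h : ∫⁻ ω, ENNReal.ofReal (c * ‖w ω‖ ^ r) ∂μ ≤ A) :
    eLpNorm w (ENNReal.ofReal r) μ ≤ (A / ENNReal.ofReal c) ^ (1 / r) := by
  rw [eLpNorm_eq_lintegral_rpow_enorm_toReal (by simpa using hr) ENNReal.ofReal_ne_top,
    ENNReal.toReal_ofReal hr.le]
  refine ENNReal.rpow_le_rpow ?_ (by positivity)
  rw [ENNReal.le_div_iff_mul_le (Or.inl (by simpa using hc)) (Or.inl ENNReal.ofReal_ne_top),
    mul_comm, ← lintegral_const_mul' _ _ ENNReal.ofReal_ne_top]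
  refine le_trans (le_of_eq (lintegral_congr fun ω => ?_)) h
  rw [ENNReal.ofReal_mul hc.le, ← ENNReal.ofReal_rpow_of_nonneg (norm_nonneg _) hr.le, ofReal_norm]

theorem IsMeasurableRepresentative.aemeasurable_comp {f : E n → E n → Ω → EReal}
    (hf : IsMeasurableRepresentative μ f) {u v : Ω → E n} (hu : AEStronglyMeasurable u μ)
    (hv : AEStronglyMeasurable v μ) : AEMeasurable (fun ω => f (u ω) (v ω) ω) μ :=
  hf.measurable.comp_aemeasurable ((hu.aemeasurable.prodMk hv.aemeasurable).prodMk aemeasurable_id)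

/-- Convex integral functionals which are coercive attain their infimum over the solenoidal and
potential fields of given mean. -/
theorem exists_lintegral_excess_le [IsProbabilityMeasure μ] (hT : IsDynamicalSystem μ T) {p q : ℝ}
    (hpq : p.HolderConjugate q) {f : E n → E n → Ω → EReal} (hf : IsMeasurableRepresentative μ f)
    {c : ℝ} {k : Ω → ℝ} (hc : 0 < c) (hk : Integrable k μ)
    (hfc : ∀ x y ω, ((c * (‖x‖ ^ p + ‖y‖ ^ q) + k ω : ℝ) : EReal) ≤ f x y ω) {ξ η : E n} {m : ℝ}
    (hinf : ∀ j : ℕ, ∃ u ∈ LpSol μ T p, ∃ v ∈ LpPot μ T q, ∫ ω, u ω ∂μ = ξ ∧ ∫ ω, v ω ∂μ = η ∧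
      ∫⁻ ω, excess (f (u ω) (v ω) ω) (k ω) ∂μ ≤ ENNReal.ofReal (m + 1 / ((j : ℝ) + 1))) :
    ∃ u ∈ LpSol μ T p, ∃ v ∈ LpPot μ T q, ∫ ω, u ω ∂μ = ξ ∧ ∫ ω, v ω ∂μ = η ∧
      ∫⁻ ω, excess (f (u ω) (v ω) ω) (k ω) ∂μ ≤ ENNReal.ofReal m := by
  have hp1 : 1 < p := hpq.lt
  have hq1 : 1 < q := hpq.symm.lt
  have hP1 : 1 < ENNReal.ofReal p := by simpa using hp1
  have hQ1 : 1 < ENNReal.ofReal q := by simpa using hq1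
  have hg𝒯 : ∀ ψ ∈ gradientTests n, IsTestField ψ := fun _ => isTestField_of_mem_gradientTests
  have hc𝒯 : ∀ ψ ∈ curlTests n, IsTestField ψ := fun _ => isTestField_of_mem_curlTests
  simp only [LpSol_eq_LpAnn hp1.le, LpPot_eq_LpAnn] at hinf ⊢
  -- Pairs take values in the Hilbert product, since the strict convexity of `bracket` rests on the
  -- parallelogram law.
  set C : ℕ → Set (Ω → WithLp 2 (E n × E n)) := fun j => {w |
    (fun ω => (w ω).fst) ∈ LpAnn μ T (gradientTests n) p ∧
    (fun ω => (w ω).snd) ∈ LpAnn μ T (curlTests n) q ∧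
    ∫ ω, (w ω).fst ∂μ = ξ ∧ ∫ ω, (w ω).snd ∂μ = η ∧
    ∫⁻ ω, excess (f (w ω).fst (w ω).snd ω) (k ω) ∂μ ≤
      ENNReal.ofReal (m + 1 / ((j : ℝ) + 1))} with hC
  have hlow : ∀ x y ω, (k ω : EReal) ≤ f x y ω := fun x y ω =>
    le_trans (EReal.coe_le_coe_iff.2 (le_add_of_nonneg_left (by positivity))) (hfc x y ω)
  -- The level of `C 0`, the largest of the sets; coercivity turns it into bounds `Mp`, `Mq` valid
  -- for the whole sequence.
  set A := ENNReal.ofReal (m + 1 / (((0 : ℕ) : ℝ) + 1)) with hA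
  set Mp := (A / ENNReal.ofReal c) ^ (1 / p) with hMp
  set Mq := (A / ENNReal.ofReal c) ^ (1 / q) with hMq
  have hAc : A / ENNReal.ofReal c ≠ ∞ :=
    ENNReal.div_ne_top ENNReal.ofReal_ne_top (by simpa using hc)
  have hMp' : Mp ≠ ∞ := ENNReal.rpow_ne_top_of_nonneg (by positivity) hAc
  have hMq' : Mq ≠ ∞ := ENNReal.rpow_ne_top_of_nonneg (by have := hpq.symm.pos; positivity) hAc
  have hanti : Antitone C := by
    rintro i j hij w ⟨h1, h2, h3, h4, h5⟩
    refine ⟨h1, h2, h3, h4, h5.trans (ENNReal.ofReal_le_ofReal ?_)⟩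
    gcongr
  have hsub : ∀ j, C j ⊆ C 0 := fun j => hanti (Nat.zero_le j)
  have hbp : ∀ w ∈ C 0, eLpNorm (fun ω => (w ω).fst) (ENNReal.ofReal p) μ ≤ Mp := by
    rintro w ⟨-, -, -, -, h5⟩
    refine eLpNorm_le_of_lintegral_le hpq.pos hc (le_trans (lintegral_mono fun ω => ?_) h5)
    refine ofReal_le_excess (le_trans (EReal.coe_le_coe_iff.2 ?_) (hfc _ (w ω).snd ω))
    have : 0 ≤ c * ‖(w ω).snd‖ ^ q := by positivity
    linarith
  have hbq : ∀ w ∈ C 0, eLpNorm (fun ω => (w ω).snd) (ENNReal.ofReal q) μ ≤ Mq := by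
    rintro w ⟨-, -, -, -, h5⟩
    refine eLpNorm_le_of_lintegral_le hpq.symm.pos hc (le_trans (lintegral_mono fun ω => ?_) h5)
    refine ofReal_le_excess (le_trans (EReal.coe_le_coe_iff.2 ?_) (hfc (w ω).fst _ ω))
    have : 0 ≤ c * ‖(w ω).fst‖ ^ p := by positivity
    linarith
  have hne : ∀ j, (C j).Nonempty := fun j => by
    obtain ⟨u, hu, v, hv, h1, h2, h3⟩ := hinf j
    exact ⟨fun ω => WithLp.toLp 2 (u ω, v ω), hu, hv, h1, h2, h3⟩
  have hconv : ∀ j, ∀ a ∈ C j, ∀ b ∈ C j, (fun ω => (1 / 2 : ℝ) • (a ω + b ω)) ∈ C j := by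
    rintro j a ⟨a1, a2, a3, a4, a5⟩ b ⟨b1, b2, b3, b4, b5⟩
    refine ⟨LpAnn.midpoint hg𝒯 hp1.le a1 b1, LpAnn.midpoint hc𝒯 hq1.le a2 b2, ?_, ?_, ?_⟩
    · simp only [WithLp.smul_fst, WithLp.add_fst]
      rw [integral_smul, integral_add (a1.1.integrable hP1.le) (b1.1.integrable hP1.le), a3, b3,
        ← two_smul ℝ, smul_smul]
      simp
    · simp only [WithLp.smul_snd, WithLp.add_snd]
      rw [integral_smul, integral_add (a2.1.integrable hQ1.le) (b2.1.integrable hQ1.le), a4, b4,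
        ← two_smul ℝ, smul_smul]
      simp
    · have hle : ∀ᵐ ω ∂μ, excess (f ((1 / 2 : ℝ) • (a ω + b ω)).fst
          ((1 / 2 : ℝ) • (a ω + b ω)).snd ω) (k ω) ≤
          2⁻¹ * excess (f (a ω).fst (a ω).snd ω) (k ω) +
            2⁻¹ * excess (f (b ω).fst (b ω).snd ω) (k ω) := by
        filter_upwards [hf.convex] with ω hω
        refine excess_midpoint_le (hlow _ _ _) (hlow _ _ _) ?_
        simp only [WithLp.smul_fst, WithLp.add_fst, WithLp.smul_snd, WithLp.add_snd, smul_add]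
        exact hω _ _ _ _ _ _ (by norm_num) (by norm_num) (by norm_num)
      have hma : AEMeasurable (fun ω => excess (f (a ω).fst (a ω).snd ω) (k ω)) μ :=
        aemeasurable_excess (hf.aemeasurable_comp a1.1.1 a2.1.1) hk.1.aemeasurable
      refine (lintegral_mono_ae hle).trans ?_
      rw [lintegral_add_left' (hma.const_mul _), lintegral_const_mul' _ _ (by simp),
        lintegral_const_mul' _ _ (by simp)]
      refine (add_le_add (mul_le_mul_right a5 _) (mul_le_mul_right b5 _)).trans (le_of_eq ?_)
      rw [← add_mul, ENNReal.inv_two_add_inv_two, one_mul]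
  have hmeas : ∀ w ∈ C 0, AEStronglyMeasurable w μ := fun w hw => by
    have := (WithLp.prod_continuous_toLp 2 (E n) (E n)).comp_aestronglyMeasurable
      (hw.1.1.1.prodMk hw.2.1.1.1)
    exact this
  have hnorm : ∀ z : WithLp 2 (E n × E n), ‖z‖ ≤ ‖z.fst‖ + ‖z.snd‖ := fun z => by
    refine abs_le_of_sq_le_sq' ?_ (by positivity) |>.2
    rw [WithLp.prod_norm_sq_eq_of_L2]
    nlinarith [norm_nonneg z.fst, norm_nonneg z.snd]
  have hint : ∀ w ∈ C 0, Integrable w μ := fun w hw =>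
    ((hw.1.1.integrable hP1.le).norm.add (hw.2.1.1.integrable hQ1.le).norm).mono' (hmeas w hw)
      (Eventually.of_forall fun ω => hnorm _)
  have hL1 : ∀ w ∈ C 0, ∫ ω, ‖w ω‖ ∂μ ≤ Mp.toReal + Mq.toReal := fun w hw => by
    have i1 := (hw.1.1.integrable hP1.le).norm
    have i2 := (hw.2.1.1.integrable hQ1.le).norm
    calc ∫ ω, ‖w ω‖ ∂μ ≤ ∫ ω, (‖(w ω).fst‖ + ‖(w ω).snd‖) ∂μ :=
          integral_mono (hint w hw).norm (i1.add i2) fun ω => hnorm _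
      _ = ∫ ω, ‖(w ω).fst‖ ∂μ + ∫ ω, ‖(w ω).snd‖ ∂μ := integral_add i1 i2
      _ ≤ Mp.toReal + Mq.toReal := add_le_add
          (integral_norm_le_of_eLpNorm_le hP1.le hMp' hw.1.1.1 (hbp w hw))
          (integral_norm_le_of_eLpNorm_le hQ1.le hMq' hw.2.1.1.1 (hbq w hw))
  obtain ⟨w, φ, w', hφ, hwC, -, hlim⟩ := exists_nearMinimizer_tendsto hanti hne hconv hint hL1
  have hw0 : ∀ j, w (φ j) ∈ C 0 := fun j => hsub _ (hwC _)
  have hlim1 : ∀ᵐ ω ∂μ, Tendsto (fun j => (w (φ j) ω).fst) atTop (𝓝 (w' ω).fst) := by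
    filter_upwards [hlim] with ω hω
    exact ((WithLp.continuous_fst 2 (E n) (E n)).tendsto _).comp hω
  have hlim2 : ∀ᵐ ω ∂μ, Tendsto (fun j => (w (φ j) ω).snd) atTop (𝓝 (w' ω).snd) := by
    filter_upwards [hlim] with ω hω
    exact ((WithLp.continuous_snd 2 (E n) (E n)).tendsto _).comp hω
  refine ⟨fun ω => (w' ω).fst,
    LpAnn.of_tendsto_ae hT hg𝒯 hp1 hMp' (fun j => (hw0 j).1) (fun j => hbp _ (hw0 j)) hlim1,
    fun ω => (w' ω).snd,
    LpAnn.of_tendsto_ae hT hc𝒯 hq1 hMq' (fun j => (hw0 j).2.1) (fun j => hbq _ (hw0 j)) hlim2,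
    ?_, ?_, ?_⟩
  · have := tendsto_integral_of_bounded hP1 hMp' (fun j => (hw0 j).1.1.1)
      (fun j => hbp _ (hw0 j)) hlim1
    simp only [fun j => (hw0 j).2.2.1] at this
    exact tendsto_nhds_unique this tendsto_const_nhds
  · have := tendsto_integral_of_bounded hQ1 hMq' (fun j => (hw0 j).2.1.1.1)
      (fun j => hbq _ (hw0 j)) hlim2
    simp only [fun j => (hw0 j).2.2.2.1] at this
    exact tendsto_nhds_unique this tendsto_const_nhds
  -- Subtracting `k` makes the integrands nonnegative, so pointwise lower semicontinuity and Fatou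
  -- apply while the levels decrease to `m`.
  · have hfatou : ∀ᵐ ω ∂μ, excess (f (w' ω).fst (w' ω).snd ω) (k ω) ≤
        liminf (fun j => excess (f (w (φ j) ω).fst (w (φ j) ω).snd ω) (k ω)) atTop := by
      filter_upwards [hf.lsc, hlim1, hlim2] with ω h1 h2 h3
      have h4 := (continuous_excess (k ω)).comp_lowerSemicontinuous h1
        fun _ _ hxy => excess_mono hxy _
      have h5 := (h2.prodMk_nhds h3)
      refine (h4.le_liminf ((w' ω).fst, (w' ω).snd)).trans ?_
      exact liminf_le_liminf_of_le h5
    have hlimc : Tendsto (fun j => ENNReal.ofReal (m + 1 / ((φ j : ℝ) + 1))) atTop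
        (𝓝 (ENNReal.ofReal m)) := by
      refine ENNReal.tendsto_ofReal ?_
      simpa using (tendsto_one_div_add_atTop_nhds_zero_nat.comp hφ.tendsto_atTop).const_add m
    calc ∫⁻ ω, excess (f (w' ω).fst (w' ω).snd ω) (k ω) ∂μ
        ≤ ∫⁻ ω, liminf (fun j => excess (f (w (φ j) ω).fst (w (φ j) ω).snd ω) (k ω)) atTop ∂μ :=
          lintegral_mono_ae hfatou
      _ ≤ liminf (fun j => ∫⁻ ω, excess (f (w (φ j) ω).fst (w (φ j) ω).snd ω) (k ω) ∂μ) atTop :=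
          lintegral_liminf_le' fun j => aemeasurable_excess
            (hf.aemeasurable_comp (hw0 j).1.1.1 (hw0 j).2.1.1.1) hk.1.aemeasurable
      _ ≤ liminf (fun j => ENNReal.ofReal (m + 1 / ((φ j : ℝ) + 1))) atTop :=
          liminf_le_liminf (Eventually.of_forall fun j => (hwC (φ j)).2.2.2.2)
      _ = ENNReal.ofReal m := hlimc.liminf_eq

end Minimizer

end ScaleInt

/-! ### Scale disintegration: minimizers lie on the graph -/

theorem lemma3p5 {n : ℕ} (hn : 1 ≤ n) {Ω : Type*} [MeasurableSpace Ω]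
    (μ : Measure Ω) [IsProbabilityMeasure μ]
    (T : ScaleInt.E n → Ω → Ω) (hT : ScaleInt.IsDynamicalSystem μ T)
    (hTerg : ScaleInt.IsErgodic μ T)
    (p q : ℝ) (hp : 1 < p) (hq : q = p / (p - 1))
    (α : ScaleInt.E n → Ω → Set (ScaleInt.E n)) (hα : ScaleInt.IsRandomMaximalMonotone μ α)
    (f : ScaleInt.E n → ScaleInt.E n → Ω → EReal)
    (hf : ScaleInt.IsMeasurableRepresentative μ f)
    (hfα : ScaleInt.Represents μ f α)
    (hfc : ScaleInt.IsCoercive μ p q f)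
    (ξ η : ScaleInt.E n) (hη : η ∈ ScaleInt.scaleIntegration μ T p q f ξ) :
    ∃ u ∈ ScaleInt.LpSol μ T p, ∃ v ∈ ScaleInt.LpPot μ T q,
      (∀ᵐ ω ∂μ, v ω ∈ α (u ω) ω) ∧
      ∫ ω, u ω ∂μ = ξ ∧ ∫ ω, v ω ∂μ = η ∧
      ∫ ω, v ω ∂μ ∈ ScaleInt.scaleIntegration μ T p q f (∫ ω, u ω ∂μ) := by

  open ScaleInt in
  have hpq : p.HolderConjugate q := (Real.holderConjugate_iff_eq_conjExponent hp).2 hq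
  have hP1 : 1 < ENNReal.ofReal p := by simpa using hp
  have hQ1 : 1 < ENNReal.ofReal q := by simpa using hpq.symm.lt
  obtain ⟨c, k, hc, hk, hfc⟩ := hfc
  have hlow : ∀ x y ω, (k ω : EReal) ≤ f x y ω := fun x y ω =>
    le_trans (EReal.coe_le_coe_iff.2 (le_add_of_nonneg_left (by positivity))) (hfc x y ω)
  have hη' : homogenized μ T p q f ξ η = ((inner ℝ ξ η : ℝ) : EReal) := hη
  -- The minimal value after the integrable lower bound `k` has been subtracted.
  set m : ℝ := inner ℝ ξ η - ∫ ω, k ω ∂μ with hm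
  have hinf : ∀ j : ℕ, ∃ u ∈ LpSol μ T p, ∃ v ∈ LpPot μ T q,
      ∫ ω, u ω ∂μ = ξ ∧ ∫ ω, v ω ∂μ = η ∧
      ((∫⁻ ω, excess (f (u ω) (v ω) ω) (k ω) ∂μ : ℝ≥0∞) : EReal) <
        ((m + 1 / ((j : ℝ) + 1) : ℝ) : EReal) := by
    intro j
    have hj : (0 : ℝ) < 1 / ((j : ℝ) + 1) := by positivity
    have hlt : homogenized μ T p q f ξ η <
        ((inner ℝ ξ η + 1 / ((j : ℝ) + 1) : ℝ) : EReal) := by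
      rw [hη']
      exact EReal.coe_lt_coe_iff.2 (lt_add_of_pos_right _ hj)
    simp only [homogenized, iInf_lt_iff] at hlt
    obtain ⟨u, hu, v, hv, hlt⟩ := hlt
    have hu' : (fun ω => ξ + u ω) ∈ LpSol μ T p := by
      have := hu.1
      rw [LpSol_eq_LpAnn hp.le] at this ⊢
      exact LpAnn.const_add (fun _ => isTestField_of_mem_gradientTests) hp.le this ξ
    have hv' : (fun ω => η + v ω) ∈ LpPot μ T q := by
      have := hv.1
      rw [LpPot_eq_LpAnn] at this ⊢
      exact LpAnn.const_add (fun _ => isTestField_of_mem_curlTests) hpq.symm.lt.le this η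
    refine ⟨_, hu', _, hv', ?_, ?_, ?_⟩
    · rw [integral_add (integrable_const ξ) (hu.1.1.integrable hP1.le), hu.2]
      simp
    · rw [integral_add (integrable_const η) (hv.1.1.integrable hQ1.le), hv.2]
      simp
    · rw [extIntegral_eq (hf.aemeasurable_comp hu'.1.1 hv'.1.1) hk
        (Filter.Eventually.of_forall fun ω => hlow _ _ ω)] at hlt
      have := (EReal.lt_sub_iff_add_lt (Or.inl (EReal.coe_ne_bot _))
        (Or.inl (EReal.coe_ne_top _))).2 hlt
      rw [← EReal.coe_sub] at this
      convert this using 2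
      rw [hm]; ring
  -- Integrals of excesses are nonnegative and come arbitrarily close to `m`. Without this sign
  -- `ENNReal.ofReal m` would be truncated to zero, and the bound below would not return `ξ · η`.
  have hm0 : 0 ≤ m := by
    by_contra h
    obtain ⟨j, hj⟩ := exists_nat_one_div_lt (neg_pos.2 (not_le.1 h))
    obtain ⟨u, -, v, -, -, -, hlt⟩ := hinf j
    have h0 := (EReal.coe_ennreal_nonneg _).trans_lt hlt
    have h1 : 0 < m + 1 / ((j : ℝ) + 1) := by exact_mod_cast h0
    linarith
  obtain ⟨u, hu, v, hv, hEu, hEv, hle⟩ := exists_lintegral_excess_le hT hpq hf hc hk hfc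
    (ξ := ξ) (η := η) (m := m) fun j => by
      obtain ⟨u, hu, v, hv, h1, h2, hlt⟩ := hinf j
      refine ⟨u, hu, v, hv, h1, h2, ?_⟩
      have := EReal.toENNReal_le_toENNReal hlt.le
      rwa [EReal.toENNReal_coe, EReal.real_coe_toENNReal] at this
  refine ⟨u, hu, v, hv, ?_, hEu, hEv, by rw [hEu, hEv]; exact hη⟩
  have hconj := hpq.ennrealOfReal
  have hs : MeasureTheory.Integrable (fun ω => (inner ℝ (u ω) (v ω) : ℝ)) μ :=
    integrable_inner_of_memLp hu.1 hv.1
  have hsE : ∫ ω, (inner ℝ (u ω) (v ω) : ℝ) ∂μ = inner ℝ ξ η := by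
    rw [integral_inner_sol_pot hT hTerg hpq hu hv, hEu, hEv]
  have hfm := hf.aemeasurable_comp hu.1.1 hv.1.1
  have hge : ∀ᵐ ω ∂μ, ((inner ℝ (u ω) (v ω) : ℝ) : EReal) ≤ f (u ω) (v ω) ω := by
    filter_upwards [hf.ge_inner] with ω hω
    rw [real_inner_comm]
    exact hω _ _
  have e1 := extIntegral_eq hfm hk (Filter.Eventually.of_forall fun ω => hlow _ _ ω)
  have e2 := extIntegral_eq hfm hs hge
  -- The same integral of `f` is computed relative to two lower bounds: `k`, where minimality gives
  -- at most `ξ · η`, and `u · v`, whose mean is `ξ · η` by the div-curl identity. The excess over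
  -- `u · v` therefore has integral zero.
  have hzero : ∫⁻ ω, excess (f (u ω) (v ω) ω) (inner ℝ (u ω) (v ω)) ∂μ = 0 := by
    have hle' : extIntegral μ (fun ω => f (u ω) (v ω) ω) ≤ ((inner ℝ ξ η : ℝ) : EReal) := by
      rw [e1]
      have h1 := EReal.coe_ennreal_le_coe_ennreal_iff.2 hle
      rw [EReal.coe_ennreal_ofReal, max_eq_left hm0] at h1
      refine (add_le_add_left h1 _).trans (le_of_eq ?_)
      rw [← EReal.coe_add, hm, sub_add_cancel]
    rw [e2, hsE] at hle'
    have h2 := (EReal.le_sub_iff_add_le (Or.inl (EReal.coe_ne_bot _))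
      (Or.inl (EReal.coe_ne_top _))).2 hle'
    rw [← EReal.coe_sub, sub_self, EReal.coe_zero] at h2
    exact_mod_cast le_antisymm h2 (EReal.coe_ennreal_nonneg _)
  rw [MeasureTheory.lintegral_eq_zero_iff' (aemeasurable_excess hfm hs.1.aemeasurable)] at hzero
  filter_upwards [hzero, hge, hfα] with ω h1 h2 h3
  rw [h3, real_inner_comm]
  exact le_antisymm (excess_eq_zero h1) h2
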